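/- Let $q$ be an odd prime and let $\mathbb{Z}_q=\{x\in\mathbb{Q}_q:|x|\le 1\}$. Let $\chi$ be the additive character of $\mathbb{Q}_q$ given by $\chi(x)=e^{2\pi i\sum_{j<0}a_jq^j}$ for $x=\sum_{j\ge k}a_jq^j$ with $a_j\in\{0,\dots,q-1\}$. Let $dx$ be the Haar measure on $\mathbb{Q}_q^2$ for which $\mathbb{Z}_q^2$ has volume $1$. For a Schwartz (locally constant, compactly supported) function $f:\mathbb{Q}_q^2\to\mathbb{C}$ put $\widehat f(\xi)=\int_{\mathbb{Q}_q^2} f(x)\chi(-x\cdot\xi)\,dx$, and for an interval $J\subset\mathbb{Z}_q$ let $f_J$ be the function with $\widehat{f_J}=\widehat f\,1_{J\times\mathbb{Q}_q}$. Let $\delta=q^{-k}$ with $k\in\{0,1,2,\dots\}$, let $P_\delta$ be the partition of $\mathbb{Z}_q$ into intervals $K=\{\xi:|\xi-a|\le\delta\}$ of length $\delta$, and for $K\in P_\delta$ put $\theta_K=\{(\xi,\eta)\in\mathbb{Q}_q^2:\xi\in K,\ |\eta-\xi^2|\le\delta^2\}$. For $1\le p\le\infty$ let $D_p(\delta)$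 be the best (smallest) constant such that $$\|f\|_{L^p(\mathbb{Q}_q^2)}\le D_p(\delta)\Big(\sum_{K\in P_\delta}\|f_K\|_{L^p(\mathbb{Q}_q^2)}^2\Big)^{1/2}$$ for all Schwartz functions $f$ on $\mathbb{Q}_q^2$ whose Fourier transform is supported in $\bigcup_{K\in P_\delta}\theta_K$. Let $1\le p_0,p_1\le\infty$ and $0\le\theta\le1$, and let $p$ be given by $\frac1p=\frac{\theta}{p_0}+\frac{1-\theta}{p_1}$ (with $1/\infty=0$). Then $$D_p(\delta)\le D_{p_0}(\delta)^{\theta}\,D_{p_1}(\delta)^{1-\theta}.$$ -/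

import Mathlib

open MeasureTheory
open scoped ENNReal

noncomputable section

namespace PadicDecoupling

variable (q : ℕ) [Fact q.Prime]

/-! ## The standard additive character of `ℚ_q` -/

/-- `fracExp x` is the number of `q`-adic digits of `x` after the point: `max (-v(x)) 0`. -/
def fracExp (x : ℚ_[q]) : ℕ := (-x.valuation).toNat

theorem norm_pow_fracExp_mul_le (x : ℚ_[q]) : ‖(q : ℚ_[q]) ^ fracExp q x * x‖ ≤ 1 := by
  by_cases hx : x = 0
  · simp [hx]
  have hq : (q : ℚ_[q]) ≠ 0 := by exact_mod_cast (Fact.out : q.Prime).ne_zero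
  rw [Padic.norm_le_one_iff_val_nonneg, Padic.valuation_mul (pow_ne_zero _ hq) hx,
    Padic.valuation_pow, Padic.valuation_p, fracExp]
  omega

/-- The fractional part of `x = ∑_{j ≥ k} a_j q^j` (with digits `a_j ∈ {0, …, q - 1}`), i.e. the
rational number `∑_{j < 0} a_j q^j`. It is computed by reading the first `n = fracExp x` digits
of the `q`-adic integer `q^n x` and dividing by `q^n`. -/
def padicFract (x : ℚ_[q]) : ℚ :=
  (PadicInt.appr (⟨(q : ℚ_[q]) ^ fracExp q x * x, norm_pow_fracExp_mul_le q x⟩ : ℤ_[q])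
    (fracExp q x) : ℚ) / (q : ℚ) ^ fracExp q x

theorem norm_sub_padicFract_le (x : ℚ_[q]) : ‖x - (padicFract q x : ℚ_[q])‖ ≤ 1 := by
  have hq : (q : ℚ_[q]) ≠ 0 := by exact_mod_cast (Fact.out : q.Prime).ne_zero
  set n := fracExp q x with hn
  set y : ℤ_[q] := ⟨(q : ℚ_[q]) ^ n * x, norm_pow_fracExp_mul_le q x⟩ with hy
  obtain ⟨e, he⟩ := Ideal.mem_span_singleton.mp (PadicInt.appr_spec n y)
  have h1 : (q : ℚ_[q]) ^ n * x - (y.appr n : ℚ_[q]) = (q : ℚ_[q]) ^ n * (e : ℚ_[q]) := by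
    have := congrArg (fun z : ℤ_[q] => (z : ℚ_[q])) he
    simp only [PadicInt.coe_sub, PadicInt.coe_mul, PadicInt.coe_natCast, PadicInt.coe_pow] at this
    exact this
  have h2 : x - (padicFract q x : ℚ_[q]) = (e : ℚ_[q]) := by
    have h3 : (padicFract q x : ℚ_[q]) = (y.appr n : ℚ_[q]) / (q : ℚ_[q]) ^ n := by
      simp [padicFract, hy, hn]
    rw [h3]
    field_simp
    linear_combination h1
  rw [h2]
  exact e.2

theorem exists_int_of_norm_le_one (d : ℚ) (N : ℕ) (m : ℤ) (hd : d * (q : ℚ) ^ N = m)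
    (h : ‖(d : ℚ_[q])‖ ≤ 1) : ∃ k : ℤ, d = k := by
  have hq0 : (q : ℚ) ≠ 0 := by exact_mod_cast (Fact.out : q.Prime).ne_zero
  have h1 : (m : ℚ_[q]) = (d : ℚ_[q]) * (q : ℚ_[q]) ^ N := by
    have := congrArg (fun z : ℚ => (z : ℚ_[q])) hd
    push_cast at this
    exact this.symm
  have h2 : ‖(m : ℚ_[q])‖ ≤ (q : ℝ) ^ (-N : ℤ) := by
    rw [h1, norm_mul, norm_pow, Padic.norm_p, zpow_neg, zpow_natCast, inv_pow]
    exact mul_le_of_le_one_left (by positivity) h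
  obtain ⟨k, hk⟩ := (Padic.norm_int_le_pow_iff_dvd m N).mp h2
  refine ⟨k, ?_⟩
  have h3 : d * (q : ℚ) ^ N = k * (q : ℚ) ^ N := by
    rw [hd, hk]; push_cast; ring
  exact mul_right_cancel₀ (pow_ne_zero _ hq0) h3

theorem exists_padicFract_add (x y : ℚ_[q]) :
    ∃ k : ℤ, padicFract q (x + y) = padicFract q x + padicFract q y + k := by
  have hq0 : (q : ℚ) ≠ 0 := by exact_mod_cast (Fact.out : q.Prime).ne_zero
  have hform : ∀ z : ℚ_[q], ∃ a : ℤ, padicFract q z * (q : ℚ) ^ fracExp q z = a := fun z =>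
    ⟨(PadicInt.appr _ _ : ℕ), by
      unfold padicFract
      rw [div_mul_cancel₀ _ (pow_ne_zero _ hq0)]
      push_cast
      rfl⟩
  obtain ⟨a, ha⟩ := hform x
  obtain ⟨b, hb⟩ := hform y
  obtain ⟨c, hc⟩ := hform (x + y)
  obtain ⟨k, hk⟩ := exists_int_of_norm_le_one q
    (padicFract q (x + y) - padicFract q x - padicFract q y)
    (fracExp q x + fracExp q y + fracExp q (x + y))
    (c * q ^ fracExp q x * q ^ fracExp q y - a * q ^ fracExp q y * q ^ fracExp q (x + y)
      - b * q ^ fracExp q x * q ^ fracExp q (x + y))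
    (by push_cast; rw [← ha, ← hb, ← hc]; ring)
    (by
      have e : ((padicFract q (x + y) - padicFract q x - padicFract q y : ℚ) : ℚ_[q]) =
          (x - (padicFract q x : ℚ_[q])) + (y - (padicFract q y : ℚ_[q]))
            - ((x + y) - (padicFract q (x + y) : ℚ_[q])) := by
        push_cast; ring
      rw [e]
      rw [sub_eq_add_neg]
      refine (Padic.nonarchimedean _ _).trans (max_le ?_ ?_)
      · exact (Padic.nonarchimedean _ _).trans
          (max_le (norm_sub_padicFract_le q x) (norm_sub_padicFract_le q y))
      · rw [norm_neg]
        exact norm_sub_padicFract_le q (x + y))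
  exact ⟨k, by linarith⟩

/-- The standard additive character `χ(x) = e(∑_{j < 0} a_j q^j)` of `ℚ_q`, where
`x = ∑_{j ≥ k} a_j q^j` and `e(t) = exp(2πit)`. -/
def chi : AddChar ℚ_[q] Circle where
  toFun x := Circle.exp (2 * Real.pi * (padicFract q x : ℝ))
  map_zero_eq_one' := by
    have h : padicFract q 0 = 0 := by simp [padicFract, fracExp, PadicInt.appr]
    simp [h]
  map_add_eq_mul' x y := by
    obtain ⟨k, hk⟩ := exists_padicFract_add q x y
    have h : 2 * Real.pi * (padicFract q (x + y) : ℝ) =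
        2 * Real.pi * (padicFract q x : ℝ) + 2 * Real.pi * (padicFract q y : ℝ)
          + k * (2 * Real.pi) := by
      rw [hk]; push_cast; ring
    rw [h, Circle.exp_add, Circle.exp_add, Circle.exp_int_mul_two_pi, mul_one]

/-! ## Haar measure on `ℚ_q` and `ℚ_q²` -/

instance instMeasurableSpacePadic : MeasurableSpace ℚ_[q] := borel ℚ_[q]

instance instBorelSpacePadic : BorelSpace ℚ_[q] := ⟨rfl⟩

/-- `ℤ_q = {x ∈ ℚ_q : |x| ≤ 1}`, as a compact set with non-empty interior. -/
def unitBall : TopologicalSpace.PositiveCompacts ℚ_[q] where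
  carrier := Metric.closedBall 0 1
  isCompact' := isCompact_closedBall 0 1
  interior_nonempty' :=
    ⟨0, Metric.ball_subset_interior_closedBall (Metric.mem_ball_self one_pos)⟩

/-- The Haar measure of `ℚ_q` for which `ℤ_q` has volume `1`. -/
def haar : Measure ℚ_[q] := Measure.addHaarMeasure (unitBall q)

/-- The Haar measure of `ℚ_q²` for which `ℤ_q²` has volume `1`. -/
def haar2 : Measure (ℚ_[q] × ℚ_[q]) := (haar q).prod (haar q)

/-! ## Schwartz functions and the Fourier transform -/

variable {q}

/-- Schwartz (Schwartz–Bruhat) functions on `ℚ_q²`: locally constant functions with compact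
support. -/
def IsSchwartz (f : ℚ_[q] × ℚ_[q] → ℂ) : Prop :=
  IsLocallyConstant f ∧ HasCompactSupport f

/-- `x · ξ = x₁ ξ₁ + x₂ ξ₂`. -/
def dot (x ξ : ℚ_[q] × ℚ_[q]) : ℚ_[q] := x.1 * ξ.1 + x.2 * ξ.2

/-- The Fourier transform on `ℚ_q²`. -/
def fourier (f : ℚ_[q] × ℚ_[q] → ℂ) (ξ : ℚ_[q] × ℚ_[q]) : ℂ :=
  ∫ x, f x * (chi q (-dot x ξ) : ℂ) ∂haar2 q

/-- The inverse Fourier transform on `ℚ_q²`. -/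
def fourierInv (g : ℚ_[q] × ℚ_[q] → ℂ) (x : ℚ_[q] × ℚ_[q]) : ℂ :=
  ∫ ξ, g ξ * (chi q (dot x ξ) : ℂ) ∂haar2 q

/-- `f_J`, the function whose Fourier transform is `f̂ · 1_{J × ℚ_q}`. -/
def freqRestrict (f : ℚ_[q] × ℚ_[q] → ℂ) (J : Set ℚ_[q]) : ℚ_[q] × ℚ_[q] → ℂ :=
  fourierInv ((J ×ˢ (Set.univ : Set ℚ_[q])).indicator (fourier f))

/-! ## Decoupling constants for the parabola -/

variable (q)

/-- `P_δ`: the intervals `I(a, δ) = {ξ : |ξ - a| ≤ δ}` of length `δ` with `a ∈ ℤ_q`. For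
`δ ∈ q^{-ℕ}` these are the members of the partition of `ℤ_q` into intervals of length `δ`. -/
def intervals (δ : ℝ) : Set (Set ℚ_[q]) :=
  {K | ∃ a : ℚ_[q], ‖a‖ ≤ 1 ∧ K = Metric.closedBall a δ}

variable {q}

/-- `θ_J = {(ξ, η) : ξ ∈ J, |η - ξ²| ≤ r²}` for an interval `J` of length `r`. -/
def theta (J : Set ℚ_[q]) (r : ℝ) : Set (ℚ_[q] × ℚ_[q]) :=
  {z | z.1 ∈ J ∧ ‖z.2 - z.1 ^ 2‖ ≤ r ^ 2}

/-- `f` is Fourier supported in `⋃_{K ∈ P_δ} θ_K`. -/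
def IsFourierSupported (δ : ℝ) (f : ℚ_[q] × ℚ_[q] → ℂ) : Prop :=
  ∀ ξ, fourier f ξ ≠ 0 → ξ ∈ ⋃ K ∈ intervals q δ, theta K δ

variable (q)

/-- The `ℓ²L^p` decoupling constant `D_p(δ)`: the best constant `C` such that
`‖f‖_p ≤ C (∑_{K ∈ P_δ} ‖f_K‖_p²)^{1/2}` for all Schwartz functions `f` which are Fourier
supported in `⋃_{K ∈ P_δ} θ_K`. -/
def decouplingConst (p : ℝ≥0∞) (δ : ℝ) : ℝ≥0∞ :=
  sInf {C : ℝ≥0∞ | ∀ f : ℚ_[q] × ℚ_[q] → ℂ, IsSchwartz f → IsFourierSupported δ f →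
    eLpNorm f p (haar2 q) ≤
      C * (∑' K : intervals q δ, eLpNorm (freqRestrict f K) p (haar2 q) ^ 2) ^ (1 / 2 : ℝ)}

end PadicDecoupling

end

noncomputable section

namespace PadicDecoupling

/-! ## Schwartz functions -/

section Schwartz

variable {q : ℕ} [Fact q.Prime]

/-! The decoupling inequality concerns only functions with constrained Fourier support, and this
constraint is destroyed by the nonlinear deformations of Riesz–Thorin. The remedy is to bound the
unconstrained linear operator `(g_K) ↦ ∑ P_K g_K` from `ℓ²L^p` to `L^p`, where `P_K` is the Fourier
projection onto `θ_K`.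

Over `ℚ_q` nothing is lost in this passage. By the ultrametric inequality `θ_K` is exactly a
parallelogram (`theta_closedBall`), a coset of a compact open subgroup, so `P_K` is a modulated
average over the dual lattice and a contraction on every `L^p` (`eLpNorm_proj_le`). The `θ_K` are
disjoint, so the `K`-piece of `∑ P_K g_K` is `P_K g_K`, and the operator has norm at most `D_p(δ)`
(`eLpNorm_sum_intervalProj_le`). Conversely, for an admissible `f` the choice `g_K = f_K` recovers
`f`.

It remains to interpolate this operator with the exponent 2 fixed
(`eLpNorm_sum_le_of_interpolation`). Each `f_K` is deformed so that its norm on both boundary lines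
stays at most `‖f_K‖_p`; the `ℓ²` sum thus never grows. Schwartz functions take finitely many
values, so the pairing with the deformed dual function is a finite sum of exponentials, to which the
three lines theorem applies. -/

theorem IsSchwartz.exists_eq_zero_of_lt_norm {f : ℚ_[q] × ℚ_[q] → ℂ} (hf : IsSchwartz f) :
    ∃ R : ℝ, ∀ x, R < ‖x‖ → f x = 0 := by
  obtain ⟨R, hR⟩ := hf.2.isCompact.isBounded.exists_norm_le
  refine ⟨R, fun x hx => ?_⟩
  by_contra h
  exact absurd (hR x (subset_tsupport f h)) (not_le.2 hx)

theorem IsSchwartz.exists_add_eq {f : ℚ_[q] × ℚ_[q] → ℂ} (hf : IsSchwartz f) :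
    ∃ r > 0, ∀ x y, ‖y‖ < r → f (x + y) = f x := by
  obtain ⟨R, hR⟩ := hf.exists_eq_zero_of_lt_norm
  obtain ⟨r, hr, h⟩ := lebesgue_number_lemma_of_metric
    (isCompact_closedBall (0 : ℚ_[q] × ℚ_[q]) (R + 1)) (c := fun v : ℂ => f ⁻¹' {v})
    (fun v => hf.1.isOpen_fiber v) (fun x _ => Set.mem_iUnion.2 ⟨f x, rfl⟩)
  -- The cap 1 matches the margin in `R + 1`: if `‖x‖ > R + 1`, then both `x` and `x + y` lie where
  -- `f` vanishes.
  refine ⟨min r 1, lt_min hr one_pos, fun x y hy => ?_⟩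
  by_cases hx : ‖x‖ ≤ R + 1
  · obtain ⟨v, hv⟩ := h x (by simpa using hx)
    have h1 : f x = v := hv (Metric.mem_ball_self hr)
    have h2 : f (x + y) = v := hv (by simpa using hy.trans_le (min_le_left _ _))
    rw [h1, h2]
  · have h3 : ‖x‖ ≤ ‖x + y‖ + ‖y‖ := by simpa using norm_sub_le (x + y) y
    have h4 : ‖y‖ < 1 := hy.trans_le (min_le_right _ _)
    rw [hR x (by linarith), hR (x + y) (by linarith)]

theorem isSchwartz_of_add_eq {f : ℚ_[q] × ℚ_[q] → ℂ} {r R : ℝ} (hr : 0 < r)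
    (hadd : ∀ x y, ‖y‖ < r → f (x + y) = f x) (hR : ∀ x, R < ‖x‖ → f x = 0) :
    IsSchwartz f := by
  refine ⟨(IsLocallyConstant.iff_eventually_eq f).2 fun x => ?_, ?_⟩
  · filter_upwards [Metric.ball_mem_nhds x hr] with y hy
    have := hadd x (y - x) (by simpa [dist_eq_norm] using hy)
    simpa using this
  · refine HasCompactSupport.intro (isCompact_closedBall (0 : ℚ_[q] × ℚ_[q]) R) fun x hx => ?_
    exact hR x (by simpa using hx)

variable (q) in
/-- The space of Schwartz functions on `ℚ_q²`. -/
def schwartz : Submodule ℂ (ℚ_[q] × ℚ_[q] → ℂ) where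
  carrier := {f | IsSchwartz f}
  zero_mem' := ⟨IsLocallyConstant.const 0, HasCompactSupport.zero⟩
  add_mem' hf hg := ⟨hf.1.add hg.1, hf.2.add hg.2⟩
  smul_mem' c _ hf := ⟨hf.1.comp (c * ·), hf.2.smul_left (f := fun _ => c)⟩

theorem IsSchwartz.comp {f : ℚ_[q] × ℚ_[q] → ℂ} (hf : IsSchwartz f) {φ : ℂ → ℂ} (hφ : φ 0 = 0) :
    IsSchwartz (φ ∘ f) :=
  ⟨hf.1.comp φ, hf.2.comp_left hφ⟩

theorem IsSchwartz.mul {f g : ℚ_[q] × ℚ_[q] → ℂ} (hf : IsSchwartz f) (hg : IsSchwartz g) :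
    IsSchwartz (f * g) :=
  ⟨hf.1.mul hg.1, hf.2.mul_right⟩

/-- Schwartz functions thus play the role of simple functions in the interpolation argument. -/
theorem IsSchwartz.finite_range {f : ℚ_[q] × ℚ_[q] → ℂ} (hf : IsSchwartz f) :
    (Set.range f).Finite := by
  obtain ⟨R, hR⟩ := hf.exists_eq_zero_of_lt_norm
  obtain ⟨t, -, ht⟩ := (isCompact_closedBall (0 : ℚ_[q] × ℚ_[q]) R).elim_nhds_subcover
    (fun x => f ⁻¹' {f x}) fun x _ => (hf.1.isOpen_fiber (f x)).mem_nhds rfl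
  refine (((t : Set _).toFinite.image f).union (Set.finite_singleton 0)).subset ?_
  rintro _ ⟨x, rfl⟩
  by_cases hx : x ∈ Metric.closedBall (0 : ℚ_[q] × ℚ_[q]) R
  · obtain ⟨y, hy, hxy⟩ := Set.mem_iUnion₂.1 (ht hx)
    exact Or.inl ⟨y, hy, hxy.symm⟩
  · exact Or.inr (hR x (by simpa using hx))

instance : (haar q).IsAddHaarMeasure := by unfold haar; infer_instance

instance : (haar2 q).IsAddHaarMeasure := by unfold haar2; infer_instance

theorem IsSchwartz.memLp {f : ℚ_[q] × ℚ_[q] → ℂ} (hf : IsSchwartz f) (p : ℝ≥0∞) :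
    MemLp f p (haar2 q) :=
  hf.1.continuous.memLp_of_hasCompactSupport hf.2

theorem IsSchwartz.integrable {f : ℚ_[q] × ℚ_[q] → ℂ} (hf : IsSchwartz f) :
    Integrable f (haar2 q) :=
  memLp_one_iff_integrable.1 (hf.memLp 1)

end Schwartz

/-! ## Orthogonality of characters -/

section Character

variable (q : ℕ) [Fact q.Prime]

/-- Later arguments use no information about `padicFract` beyond this kernel and additivity. -/
theorem chi_eq_one_iff (x : ℚ_[q]) : chi q x = 1 ↔ ‖x‖ ≤ 1 := by
  have hχ : chi q x = Circle.exp (2 * Real.pi * (padicFract q x : ℝ)) := rfl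
  constructor
  · intro h
    rw [hχ, Circle.exp_eq_one] at h
    obtain ⟨n, hn⟩ := h
    have h1 : (padicFract q x : ℝ) = n := by
      have := Real.pi_pos
      field_simp at hn
      linarith
    have h2 : padicFract q x = n := by exact_mod_cast h1
    have h3 := norm_sub_padicFract_le q x
    rw [h2] at h3
    have h4 := IsUltrametricDist.norm_add_le_max (x - ((n : ℚ) : ℚ_[q])) ((n : ℚ) : ℚ_[q])
    rw [sub_add_cancel] at h4
    refine h4.trans (max_le h3 ?_)
    simpa using Padic.norm_int_le_one n
  · intro h
    have h1 : fracExp q x = 0 := by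
      rw [fracExp]
      have := (Padic.norm_le_one_iff_val_nonneg x).1 h
      omega
    have h2 : padicFract q x = 0 := by
      simp only [padicFract, h1]
      simp [PadicInt.appr]
    rw [hχ, h2]
    simp

theorem continuous_chi : Continuous (chi q) := by
  refine IsLocallyConstant.continuous ((IsLocallyConstant.iff_eventually_eq _).2 fun x => ?_)
  filter_upwards [Metric.ball_mem_nhds x one_pos] with y hy
  have : chi q (y - x) = 1 := (chi_eq_one_iff q _).2 (by simpa [dist_eq_norm] using hy.le)
  rw [← sub_add_cancel y x, AddChar.map_add_eq_mul, this, one_mul]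

/-- The ball is an additive group containing `c`, so translation by `c` multiplies the integral by
`chi q (x * c)`. As `c` has maximal norm in the ball, the character is trivial there exactly when
this factor is 1. -/
theorem integral_chi_closedBall (c x : ℚ_[q]) :
    ∫ s in Metric.closedBall 0 ‖c‖, (chi q (x * s) : ℂ) ∂haar q =
      if ‖x * c‖ ≤ 1 then ((haar q).real (Metric.closedBall 0 ‖c‖) : ℂ) else 0 := by
  split_ifs with h
  · have : ∀ s ∈ Metric.closedBall (0 : ℚ_[q]) ‖c‖, (chi q (x * s) : ℂ) = 1 := by
      intro s hs
      rw [(chi_eq_one_iff q _).2, Circle.coe_one]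
      rw [norm_mul] at h ⊢
      exact (mul_le_mul_of_nonneg_left (by simpa using hs) (norm_nonneg _)).trans h
    rw [setIntegral_congr_fun measurableSet_closedBall this]
    simp
  · set F : ℚ_[q] → ℂ :=
      (Metric.closedBall 0 ‖c‖).indicator fun s => (chi q (x * s) : ℂ) with hF
    have h1 : ∀ s, F (s + c) = (chi q (x * c) : ℂ) * F s := by
      intro s
      have h2 : s + c ∈ Metric.closedBall 0 ‖c‖ ↔ s ∈ Metric.closedBall 0 ‖c‖ := by
        simp only [mem_closedBall_zero_iff]
        refine ⟨fun hs => ?_, fun hs => ?_⟩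
        · have := IsUltrametricDist.norm_add_le_max (s + c) (-c)
          rw [add_neg_cancel_right, norm_neg] at this
          exact this.trans (max_le hs le_rfl)
        · exact (IsUltrametricDist.norm_add_le_max s c).trans (max_le hs le_rfl)
      by_cases hs : s ∈ Metric.closedBall 0 ‖c‖
      · rw [hF, Set.indicator_of_mem (h2.2 hs), Set.indicator_of_mem hs, mul_add,
          AddChar.map_add_eq_mul, Circle.coe_mul, mul_comm]
      · rw [hF, Set.indicator_of_notMem (mt h2.1 hs), Set.indicator_of_notMem hs, mul_zero]
    rw [← integral_indicator measurableSet_closedBall]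
    have h3 := integral_add_right_eq_self (μ := haar q) F c
    simp only [h1, integral_const_mul] at h3
    have h4 : (chi q (x * c) : ℂ) ≠ 1 := fun h' =>
      h ((chi_eq_one_iff q _).1 (Circle.ext (by simpa using h')))
    have h5 : ((chi q (x * c) : ℂ) - 1) * ∫ s, F s ∂haar q = 0 := by
      rw [sub_mul, h3, one_mul, sub_self]
    exact (mul_eq_zero.1 h5).resolve_left (sub_ne_zero.2 h4)

theorem integral_chi_closedBall_prod (c x y : ℚ_[q]) :
    ∫ z in Metric.closedBall 0 ‖c‖ ×ˢ Metric.closedBall 0 ‖c‖,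
        (chi q (x * z.1 + y * z.2) : ℂ) ∂haar2 q =
      if ‖x * c‖ ≤ 1 ∧ ‖y * c‖ ≤ 1 then
        ((haar q).real (Metric.closedBall 0 ‖c‖) : ℂ) ^ 2 else 0 := by
  simp only [AddChar.map_add_eq_mul, Circle.coe_mul]
  rw [haar2, setIntegral_prod_mul (fun s => (chi q (x * s) : ℂ)) (fun s => (chi q (y * s) : ℂ)),
    integral_chi_closedBall, integral_chi_closedBall]
  by_cases hx : ‖x * c‖ ≤ 1 <;> by_cases hy : ‖y * c‖ ≤ 1 <;> simp only [hx, hy] <;> simp [sq]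

theorem haar_real_closedBall_one : (haar q).real (Metric.closedBall 0 1) = 1 := by
  have : haar q (Metric.closedBall 0 1) = 1 := Measure.addHaarMeasure_self (K₀ := unitBall q)
  simp [Measure.real, this]

-- Such a ball is a dilate of `ℤ_q`, so its volume is a multiplicative function of `c`; reciprocal
-- radii then give reciprocal volumes with no explicit computation.
open scoped Pointwise in
theorem haar_real_closedBall_norm (c : ℚ_[q]ˣ) :
    (haar q).real (Metric.closedBall 0 ‖(c : ℚ_[q])‖) = distribHaarChar ℚ_[q] c := by
  have h : c • Metric.closedBall (0 : ℚ_[q]) 1 = Metric.closedBall 0 ‖(c : ℚ_[q])‖ := by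
    change (c : ℚ_[q]) • Metric.closedBall (0 : ℚ_[q]) 1 = _
    rw [smul_closedBall' c.ne_zero]
    simp
  rw [← h, Measure.real, ← distribHaarChar_mul, ENNReal.toReal_mul]
  have := haar_real_closedBall_one q
  rw [Measure.real] at this
  simp [this]

theorem haar_real_closedBall_norm_mul_inv {c : ℚ_[q]} (hc : c ≠ 0) :
    (haar q).real (Metric.closedBall 0 ‖c‖) * (haar q).real (Metric.closedBall 0 ‖c⁻¹‖) = 1 := by
  have h1 := haar_real_closedBall_norm q (Units.mk0 c hc)
  have h2 := haar_real_closedBall_norm q (Units.mk0 c hc)⁻¹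
  rw [Units.val_inv_eq_inv_val] at h2
  simp only [Units.val_mk0] at h1 h2
  rw [h1, h2, ← NNReal.coe_mul, ← map_mul, mul_inv_cancel, map_one, NNReal.coe_one]

end Character

/-! ## Fourier inversion -/

section Inversion

variable {q : ℕ} [Fact q.Prime]

theorem norm_coe_chi (x : ℚ_[q]) : ‖(chi q x : ℂ)‖ = 1 := Circle.norm_coe _

theorem continuous_dot : Continuous fun z : (ℚ_[q] × ℚ_[q]) × (ℚ_[q] × ℚ_[q]) => dot z.1 z.2 := by
  unfold dot
  fun_prop

theorem dot_add_left (x y ξ : ℚ_[q] × ℚ_[q]) : dot (x + y) ξ = dot x ξ + dot y ξ := by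
  simp only [dot, Prod.fst_add, Prod.snd_add]
  ring

/-- Justifies Fubini in `fourierInv_fourier` (with `L = 0`) and in `fourier_proj`: by translation
invariance all slices have the same `L¹` norm, and `ν` is finite. -/
theorem integrable_comp_sub_mul {g : ℚ_[q] × ℚ_[q] → ℂ} (hg : IsSchwartz g)
    (ν : Measure (ℚ_[q] × ℚ_[q])) [IsFiniteMeasure ν] {L : ℚ_[q] × ℚ_[q] → ℚ_[q] × ℚ_[q]}
    (hL : Continuous L) {u : (ℚ_[q] × ℚ_[q]) × (ℚ_[q] × ℚ_[q]) → ℚ_[q]} (hu : Continuous u) :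
    Integrable (fun w => g (w.2 - L w.1) * (chi q (u w) : ℂ)) (ν.prod (haar2 q)) := by
  refine Integrable.mul_bdd (c := 1) ?_
    (continuous_subtype_val.comp ((continuous_chi q).comp hu)).aestronglyMeasurable
    (.of_forall fun _ => (norm_coe_chi _).le)
  have hc : Continuous fun w : (ℚ_[q] × ℚ_[q]) × (ℚ_[q] × ℚ_[q]) => g (w.2 - L w.1) :=
    hg.1.continuous.comp (continuous_snd.sub (hL.comp continuous_fst))
  rw [integrable_prod_iff hc.aestronglyMeasurable]
  refine ⟨.of_forall fun z => hg.integrable.comp_sub_right (L z), ?_⟩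
  simp only [integral_sub_right_eq_self (μ := haar2 q) (fun y => ‖g y‖)]
  exact integrable_const _

/-- Invariance under translation by `y` gives `f̂(ξ) = χ(-y·ξ) f̂(ξ)`. Taking `y` to be `c⁻¹` along
the larger coordinate of `ξ` makes the factor differ from 1. -/
theorem fourier_eq_zero {f : ℚ_[q] × ℚ_[q] → ℂ} {c : ℚ_[q]} (hc : c ≠ 0)
    (hf : ∀ x y, ‖y‖ ≤ ‖c⁻¹‖ → f (x + y) = f x) {ξ : ℚ_[q] × ℚ_[q]} (hξ : ‖c‖ < ‖ξ‖) :
    fourier f ξ = 0 := by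
  have key : ∀ y, ‖y‖ ≤ ‖c⁻¹‖ → 1 < ‖dot y ξ‖ → fourier f ξ = 0 := by
    intro y hy hyξ
    have h1 : fourier f ξ = (chi q (-dot y ξ) : ℂ) * fourier f ξ := by
      rw [fourier, ← integral_const_mul, ← integral_add_right_eq_self _ y]
      congr 1
      ext x
      rw [hf x y hy, dot_add_left, neg_add, AddChar.map_add_eq_mul, Circle.coe_mul]
      ring
    have h2 : (chi q (-dot y ξ) : ℂ) ≠ 1 := fun h => by
      have := (chi_eq_one_iff q _).1 (Circle.ext (by simpa using h))
      rw [norm_neg] at this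
      exact absurd this (not_le.2 hyξ)
    have h3 : ((chi q (-dot y ξ) : ℂ) - 1) * fourier f ξ = 0 := by
      rw [sub_mul, ← h1, one_mul, sub_self]
    exact (mul_eq_zero.1 h3).resolve_left (sub_ne_zero.2 h2)
  have hc' : 0 < ‖c‖ := norm_pos_iff.2 hc
  rw [Prod.norm_def, lt_max_iff] at hξ
  have h1 : ∀ t : ℚ_[q], ‖c‖ < ‖t‖ → 1 < ‖c⁻¹ * t‖ := fun t ht => by
    rw [norm_mul, norm_inv, inv_mul_eq_div, one_lt_div hc']
    exact ht
  rcases hξ with h | h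
  · exact key (c⁻¹, 0) (by simp [Prod.norm_def]) (by simpa [dot] using h1 _ h)
  · exact key (0, c⁻¹) (by simp [Prod.norm_def]) (by simpa [dot] using h1 _ h)

theorem exists_norm_inv_lt (q : ℕ) [Fact q.Prime] {r : ℝ} (hr : 0 < r) :
    ∃ c : ℚ_[q], c ≠ 0 ∧ ‖c⁻¹‖ < r := by
  obtain ⟨x, hx, hxr⟩ := NormedField.exists_norm_lt ℚ_[q] hr
  exact ⟨x⁻¹, inv_ne_zero (norm_pos_iff.1 hx), by simpa using hxr⟩

/-- **Fourier inversion** for Schwartz functions on `ℚ_q²`. -/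
theorem fourierInv_fourier {f : ℚ_[q] × ℚ_[q] → ℂ} (hf : IsSchwartz f) :
    fourierInv (fourier f) = f := by
  obtain ⟨r, hr, hfr⟩ := hf.exists_add_eq
  obtain ⟨c, hc, hcr⟩ := exists_norm_inv_lt q hr
  replace hfr : ∀ x y, ‖y‖ ≤ ‖c⁻¹‖ → f (x + y) = f x := fun x y hy => hfr x y (hy.trans_lt hcr)
  set B : Set ℚ_[q] := Metric.closedBall 0 ‖c‖ with hB
  set B' : Set ℚ_[q] := Metric.closedBall 0 ‖c⁻¹‖ with hB'
  have hc' : 0 < ‖c‖ := norm_pos_iff.2 hc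
  ext x
  have h1 : fourierInv (fourier f) x =
      ∫ ξ in B ×ˢ B, fourier f ξ * (chi q (dot x ξ) : ℂ) ∂haar2 q := by
    rw [fourierInv, setIntegral_eq_integral_of_forall_compl_eq_zero]
    intro ξ hξ
    rw [fourier_eq_zero hc hfr, zero_mul]
    rw [Prod.norm_def, lt_max_iff]
    by_contra! h
    exact hξ ⟨by simpa [hB] using h.1, by simpa [hB] using h.2⟩
  have h2 : ∀ ξ, fourier f ξ * (chi q (dot x ξ) : ℂ) =
      ∫ y, f y * (chi q (dot (x - y) ξ) : ℂ) ∂haar2 q := by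
    intro ξ
    rw [fourier, ← integral_mul_const]
    congr 1
    ext y
    rw [mul_assoc, ← Circle.coe_mul, ← AddChar.map_add_eq_mul]
    congr 3
    simp only [dot, Prod.fst_sub, Prod.snd_sub]
    ring
  have hfin : haar2 q (B ×ˢ B) ≠ ∞ :=
    ((isCompact_closedBall _ _).prod (isCompact_closedBall _ _)).measure_lt_top.ne
  have : IsFiniteMeasure ((haar2 q).restrict (B ×ˢ B)) := ⟨by simpa using hfin.lt_top⟩
  -- The kernel is concentrated on `B' × B'`, at whose scale `f` is constant, so no limiting
  -- argument is needed.
  have h3 : ∀ y, f (x + y) * ∫ ξ in B ×ˢ B, (chi q (dot (x - (x + y)) ξ) : ℂ) ∂haar2 q =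
      (B' ×ˢ B').indicator (fun _ => f x * ((haar q).real B : ℂ) ^ 2) y := by
    intro y
    have e : ∀ ξ, dot (x - (x + y)) ξ = -y.1 * ξ.1 + -y.2 * ξ.2 := by
      intro ξ; simp [dot]
    rw [funext fun ξ => congrArg (fun t => (chi q t : ℂ)) (e ξ), integral_chi_closedBall_prod]
    have e2 : ∀ t : ℚ_[q], ‖-t * c‖ ≤ 1 ↔ t ∈ B' := by
      intro t
      rw [hB', mem_closedBall_zero_iff, norm_mul, norm_neg, norm_inv, ← one_div, le_div_iff₀ hc']
    by_cases hy : y ∈ B' ×ˢ B'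
    · rw [Set.indicator_of_mem hy, if_pos ⟨(e2 _).2 hy.1, (e2 _).2 hy.2⟩, hfr]
      exact max_le (by simpa [hB'] using hy.1) (by simpa [hB'] using hy.2)
    · rw [Set.indicator_of_notMem hy, if_neg fun h => hy ⟨(e2 _).1 h.1, (e2 _).1 h.2⟩, mul_zero]
  rw [h1]
  simp only [h2]
  have hswap := integral_integral_swap
    (f := fun (ξ : ℚ_[q] × ℚ_[q]) y => f y * (chi q (dot (x - y) ξ) : ℂ))
    (μ := (haar2 q).restrict (B ×ˢ B)) (ν := haar2 q) (by
    have := integrable_comp_sub_mul hf ((haar2 q).restrict (B ×ˢ B)) (L := fun _ => 0)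
      continuous_const (u := fun w => dot (x - w.2) w.1)
      (continuous_dot.comp ((continuous_const.sub continuous_snd).prodMk continuous_fst))
    simpa using! this)
  rw [hswap]
  simp only [integral_const_mul]
  rw [← integral_add_left_eq_self _ x]
  simp only [h3]
  rw [integral_indicator (measurableSet_closedBall.prod measurableSet_closedBall),
    setIntegral_const, haar2, measureReal_prod_prod]
  have h4 : ((haar q).real B : ℂ) * (haar q).real B' = 1 := by
    exact_mod_cast haar_real_closedBall_norm_mul_inv q hc
  rw [Complex.real_smul]
  push_cast
  linear_combination (f x) * (((haar q).real B : ℂ) * (haar q).real B' + 1) * h4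

theorem integrable_mul_chi {f : ℚ_[q] × ℚ_[q] → ℂ} (hf : IsSchwartz f) (ξ : ℚ_[q] × ℚ_[q]) :
    Integrable (fun x => f x * (chi q (-dot x ξ) : ℂ)) (haar2 q) :=
  hf.integrable.mul_bdd (c := 1)
    (continuous_subtype_val.comp ((continuous_chi q).comp
      (continuous_dot.comp (continuous_id.prodMk continuous_const)).neg)).aestronglyMeasurable
    (.of_forall fun _ => (norm_coe_chi _).le)

theorem fourier_sum {ι : Type*} (s : Finset ι) {f : ι → ℚ_[q] × ℚ_[q] → ℂ}
    (hf : ∀ i, IsSchwartz (f i)) : fourier (∑ i ∈ s, f i) = ∑ i ∈ s, fourier (f i) := by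
  ext ξ
  simp only [fourier, Finset.sum_apply, Finset.sum_mul]
  rw [integral_finsetSum _ fun i _ => integrable_mul_chi (hf i) ξ]

theorem IsSchwartz.eq_of_fourier_eq {f g : ℚ_[q] × ℚ_[q] → ℂ} (hf : IsSchwartz f)
    (hg : IsSchwartz g) (h : fourier f = fourier g) : f = g := by
  rw [← fourierInv_fourier hf, h, fourierInv_fourier hg]

end Inversion

/-! ## Frequency projections onto parallelograms -/

section Projection

variable {q : ℕ} [Fact q.Prime]

/-- Normalised Haar measure on `ℤ_q²`, as a probability measure on `ℚ_q²`. -/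
def cube (q : ℕ) [Fact q.Prime] : Measure (ℚ_[q] × ℚ_[q]) :=
  (haar2 q).restrict (Metric.closedBall 0 1 ×ˢ Metric.closedBall 0 1)

instance : IsProbabilityMeasure (cube q) := by
  refine ⟨?_⟩
  have : haar q (Metric.closedBall 0 1) = 1 := Measure.addHaarMeasure_self (K₀ := unitBall q)
  rw [cube, Measure.restrict_apply_univ, haar2, Measure.prod_prod, this, one_mul]

/-- The linear map taking `ℤ_q²` to the lattice dual to
`{(u, v) : ‖u‖ ≤ ‖D‖, ‖v - 2 a u‖ ≤ ‖D‖²}`. -/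
def dualLattice (D a : ℚ_[q]) (z : ℚ_[q] × ℚ_[q]) : ℚ_[q] × ℚ_[q] :=
  (z.1 / D - 2 * a * z.2 / D ^ 2, z.2 / D ^ 2)

theorem continuous_dualLattice (D a : ℚ_[q]) : Continuous (dualLattice D a) := by
  unfold dualLattice
  fun_prop

/-- The Fourier projection onto `θ_K`, where `K` is the interval of length `‖D‖` around `a`. -/
def proj (D a : ℚ_[q]) (g : ℚ_[q] × ℚ_[q] → ℂ) (x : ℚ_[q] × ℚ_[q]) : ℂ :=
  ∫ z, g (x - dualLattice D a z) * (chi q (dot (dualLattice D a z) (a, a ^ 2)) : ℂ) ∂cube q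

theorem continuous_chi_dot_dualLattice (D a : ℚ_[q]) (ξ : ℚ_[q] × ℚ_[q]) :
    Continuous fun z => (chi q (dot (dualLattice D a z) ξ) : ℂ) :=
  continuous_subtype_val.comp ((continuous_chi q).comp
    (continuous_dot.comp ((continuous_dualLattice D a).prodMk continuous_const)))

theorem IsSchwartz.proj {g : ℚ_[q] × ℚ_[q] → ℂ} (hg : IsSchwartz g) (D a : ℚ_[q]) :
    IsSchwartz (proj D a g) := by
  obtain ⟨R, hR⟩ := hg.exists_eq_zero_of_lt_norm
  obtain ⟨r, hr, hgr⟩ := hg.exists_add_eq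
  have hcpt : IsCompact (Metric.closedBall (0 : ℚ_[q]) 1 ×ˢ Metric.closedBall (0 : ℚ_[q]) 1) :=
    (isCompact_closedBall _ _).prod (isCompact_closedBall _ _)
  obtain ⟨M, hM⟩ := (hcpt.image (continuous_dualLattice D a)).isBounded.exists_norm_le
  refine isSchwartz_of_add_eq (R := R + M) hr (fun x y hy => ?_) fun x hx => ?_
  · simp only [PadicDecoupling.proj]
    congr 1
    ext z
    rw [add_sub_right_comm, hgr _ _ hy]
  · rw [PadicDecoupling.proj, cube]
    refine setIntegral_eq_zero_of_forall_eq_zero fun z hz => ?_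
    have h1 := hM _ (Set.mem_image_of_mem _ hz)
    have h2 := norm_sub_norm_le x (dualLattice D a z)
    rw [hR _ (by linarith), zero_mul]

theorem integrable_proj {g : ℚ_[q] × ℚ_[q] → ℂ} (hg : IsSchwartz g) (D a : ℚ_[q])
    (x : ℚ_[q] × ℚ_[q]) : Integrable (fun z => g (x - dualLattice D a z) *
      (chi q (dot (dualLattice D a z) (a, a ^ 2)) : ℂ)) (cube q) := by
  obtain ⟨C, hC⟩ := hg.2.exists_bound_of_continuous hg.1.continuous
  refine Integrable.of_bound (C := C) ?_ (.of_forall fun z => ?_)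
  · exact ((hg.1.continuous.comp (continuous_const.sub (continuous_dualLattice D a))).mul
      (continuous_chi_dot_dualLattice D a _)).aestronglyMeasurable
  · rw [norm_mul, norm_coe_chi, mul_one]
    exact hC _

/-- `proj` as a linear map on Schwartz functions. -/
def projLM (D a : ℚ_[q]) : schwartz q →ₗ[ℂ] schwartz q where
  toFun g := ⟨proj D a g, IsSchwartz.proj g.2 D a⟩
  map_add' g h := by
    ext x
    simp only [proj, Submodule.coe_add, Pi.add_apply, add_mul]
    exact integral_add (integrable_proj g.2 D a x) (integrable_proj h.2 D a x)
  map_smul' c g := by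
    ext x
    simp only [proj, Submodule.coe_smul, Pi.smul_apply, smul_eq_mul, RingHom.id_apply, mul_assoc]
    exact integral_const_mul _ _

/-- `proj` is convolution with a modulated probability measure; its multiplier is the integral of a
character over `ℤ_q²`, which is 1 or 0 by orthogonality. -/
theorem fourier_proj {g : ℚ_[q] × ℚ_[q] → ℂ} (hg : IsSchwartz g) {D : ℚ_[q]} (hD : D ≠ 0)
    (a : ℚ_[q]) :
    fourier (proj D a g) = {ξ : ℚ_[q] × ℚ_[q] | ‖(a - ξ.1) / D‖ ≤ 1 ∧
      ‖(a ^ 2 - ξ.2 - 2 * a * (a - ξ.1)) / D ^ 2‖ ≤ 1}.indicator (fourier g) := by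
  ext ξ
  have h1 : ∀ x, proj D a g x * (chi q (-dot x ξ) : ℂ) =
      ∫ z, g (x - dualLattice D a z) *
        (chi q (dot (dualLattice D a z) (a, a ^ 2) + -dot x ξ) : ℂ) ∂cube q := by
    intro x
    rw [proj, ← integral_mul_const]
    simp only [AddChar.map_add_eq_mul, Circle.coe_mul, mul_assoc]
  have h2 : ∀ z, ∫ x, g (x - dualLattice D a z) *
        (chi q (dot (dualLattice D a z) (a, a ^ 2) + -dot x ξ) : ℂ) ∂haar2 q =
      (chi q ((a - ξ.1) / D * z.1 + (a ^ 2 - ξ.2 - 2 * a * (a - ξ.1)) / D ^ 2 * z.2) : ℂ) *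
        fourier g ξ := by
    intro z
    rw [fourier, ← integral_const_mul, ← integral_add_right_eq_self _ (dualLattice D a z)]
    congr 1
    ext x
    rw [add_sub_cancel_right, mul_left_comm, ← Circle.coe_mul, ← AddChar.map_add_eq_mul]
    congr 3
    simp only [dot, dualLattice, Prod.fst_add, Prod.snd_add]
    field_simp
    ring
  rw [fourier]
  simp only [h1]
  have hswap := integral_integral_swap
    (f := fun (z x : ℚ_[q] × ℚ_[q]) => g (x - dualLattice D a z) *
      (chi q (dot (dualLattice D a z) (a, a ^ 2) + -dot x ξ) : ℂ))
    (μ := cube q) (ν := haar2 q)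
    (integrable_comp_sub_mul hg (cube q) (continuous_dualLattice D a)
      (u := fun w => dot (dualLattice D a w.1) (a, a ^ 2) + -dot w.2 ξ)
      (by
        have := continuous_dualLattice D a
        unfold dot
        fun_prop))
  rw [← hswap]
  simp only [h2, integral_mul_const]
  have h3 := integral_chi_closedBall_prod q 1 ((a - ξ.1) / D)
    ((a ^ 2 - ξ.2 - 2 * a * (a - ξ.1)) / D ^ 2)
  rw [norm_one, haar_real_closedBall_one, mul_one, mul_one] at h3
  rw [cube, h3, Set.indicator_apply]
  by_cases h : ‖(a - ξ.1) / D‖ ≤ 1 ∧ ‖(a ^ 2 - ξ.2 - 2 * a * (a - ξ.1)) / D ^ 2‖ ≤ 1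
  · simp only [Set.mem_ofPred_eq, if_pos h]
    simp
  · simp only [Set.mem_ofPred_eq, if_neg h]
    simp

/-- The parabola deviates from its tangent at `a` by `(a - ξ₁)²`, of norm at most `‖D‖²`; the
ultrametric inequality absorbs it without enlarging the set. -/
theorem theta_closedBall {D : ℚ_[q]} (hD : D ≠ 0) (a : ℚ_[q]) :
    theta (Metric.closedBall a ‖D‖) ‖D‖ = {ξ : ℚ_[q] × ℚ_[q] | ‖(a - ξ.1) / D‖ ≤ 1 ∧
      ‖(a ^ 2 - ξ.2 - 2 * a * (a - ξ.1)) / D ^ 2‖ ≤ 1} := by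
  have hD' : 0 < ‖D‖ := norm_pos_iff.2 hD
  ext ξ
  simp only [theta, Set.mem_ofPred_eq, norm_div, norm_pow, div_le_one hD',
    div_le_one (pow_pos hD' 2),
    Metric.mem_closedBall, dist_eq_norm]
  rw [norm_sub_rev ξ.1 a]
  refine and_congr_right fun h => ?_
  have h1 : ‖(a - ξ.1) ^ 2‖ ≤ ‖D‖ ^ 2 := by
    rw [norm_pow]
    exact pow_le_pow_left₀ (norm_nonneg _) h 2
  have e : a ^ 2 - ξ.2 - 2 * a * (a - ξ.1) = -(ξ.2 - ξ.1 ^ 2) + -(a - ξ.1) ^ 2 := by ring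
  constructor
  · intro h2
    rw [e]
    refine (IsUltrametricDist.norm_add_le_max _ _).trans (max_le ?_ ?_) <;> rwa [norm_neg]
  · intro h2
    have e' : ξ.2 - ξ.1 ^ 2 = -(a ^ 2 - ξ.2 - 2 * a * (a - ξ.1)) + -(a - ξ.1) ^ 2 := by ring
    rw [e']
    refine (IsUltrametricDist.norm_add_le_max _ _).trans (max_le ?_ ?_) <;> rwa [norm_neg]

theorem fourier_proj_eq_indicator_theta {g : ℚ_[q] × ℚ_[q] → ℂ} (hg : IsSchwartz g) {D : ℚ_[q]}
    (hD : D ≠ 0) (a : ℚ_[q]) :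
    fourier (proj D a g) = (theta (Metric.closedBall a ‖D‖) ‖D‖).indicator (fourier g) := by
  rw [theta_closedBall hD, fourier_proj hg hD]

theorem enorm_proj_le (D a : ℚ_[q]) (g : ℚ_[q] × ℚ_[q] → ℂ) (x : ℚ_[q] × ℚ_[q]) :
    ‖proj D a g x‖ₑ ≤ ∫⁻ z, ‖g (x - dualLattice D a z)‖ₑ ∂cube q := by
  refine (enorm_integral_le_lintegral_enorm _).trans_eq ?_
  congr 1
  ext z
  rw [enorm_mul, ← ofReal_norm (chi q _ : ℂ), norm_coe_chi, ENNReal.ofReal_one, mul_one]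

theorem enorm_le_eLpNorm_top {g : ℚ_[q] × ℚ_[q] → ℂ} (hg : Continuous g) (x : ℚ_[q] × ℚ_[q]) :
    ‖g x‖ₑ ≤ eLpNorm g ∞ (haar2 q) := by
  have ho : IsOpen {y | eLpNorm g ∞ (haar2 q) < ‖g y‖ₑ} := isOpen_lt continuous_const hg.enorm
  have h0 : haar2 q {y | eLpNorm g ∞ (haar2 q) < ‖g y‖ₑ} = 0 := by
    have := ae_le_eLpNormEssSup (f := g) (μ := haar2 q)
    rw [← eLpNorm_exponent_top] at this
    simpa [Filter.Eventually, mem_ae_iff, Set.compl_def] using this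
  rw [ho.measure_eq_zero_iff (haar2 q)] at h0
  by_contra! h
  exact (Set.eq_empty_iff_forall_notMem.1 h0 x) h

/-- An average of modulated translates over a probability measure: monotonicity of `L^p` norms on
`cube q`, then Tonelli and translation invariance. -/
theorem eLpNorm_proj_le {g : ℚ_[q] × ℚ_[q] → ℂ} (hg : IsSchwartz g) (D a : ℚ_[q]) {p : ℝ≥0∞}
    (hp : 1 ≤ p) : eLpNorm (proj D a g) p (haar2 q) ≤ eLpNorm g p (haar2 q) := by
  have hc : Continuous fun w : (ℚ_[q] × ℚ_[q]) × (ℚ_[q] × ℚ_[q]) =>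
      g (w.1 - dualLattice D a w.2) :=
    hg.1.continuous.comp (continuous_fst.sub ((continuous_dualLattice D a).comp continuous_snd))
  rcases eq_or_ne p ∞ with rfl | hpt
  · rw [eLpNorm_exponent_top (f := proj D a g)]
    refine eLpNormEssSup_le_of_ae_enorm_bound (.of_forall fun x => (enorm_proj_le D a g x).trans ?_)
    refine (lintegral_mono fun z => enorm_le_eLpNorm_top hg.1.continuous _).trans_eq ?_
    simp
  have hp0 : p ≠ 0 := (zero_lt_one.trans_le hp).ne'
  have hpr : 0 < p.toReal := ENNReal.toReal_pos hp0 hpt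
  rw [eLpNorm_eq_lintegral_rpow_enorm_toReal hp0 hpt,
    eLpNorm_eq_lintegral_rpow_enorm_toReal hp0 hpt]
  refine ENNReal.rpow_le_rpow ?_ (by positivity)
  calc ∫⁻ x, ‖proj D a g x‖ₑ ^ p.toReal ∂haar2 q
      ≤ ∫⁻ x, ∫⁻ z, ‖g (x - dualLattice D a z)‖ₑ ^ p.toReal ∂cube q ∂haar2 q := by
        refine lintegral_mono fun x => ?_
        have h1 := eLpNorm_le_eLpNorm_of_exponent_le (μ := cube q) hp
          (hc.comp (Continuous.prodMk_right x)).aestronglyMeasurable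
        rw [eLpNorm_one_eq_lintegral_enorm,
          eLpNorm_eq_lintegral_rpow_enorm_toReal hp0 hpt] at h1
        have h2 := ENNReal.rpow_le_rpow ((enorm_proj_le D a g x).trans h1) hpr.le
        rwa [← ENNReal.rpow_mul, one_div, inv_mul_cancel₀ hpr.ne', ENNReal.rpow_one] at h2
    _ = ∫⁻ z, ∫⁻ x, ‖g (x - dualLattice D a z)‖ₑ ^ p.toReal ∂haar2 q ∂cube q := by
        refine lintegral_lintegral_swap ?_
        exact (hc.enorm.measurable.pow_const _).aemeasurable
    _ = ∫⁻ x, ‖g x‖ₑ ^ p.toReal ∂haar2 q := by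
        simp only [lintegral_sub_right_eq_self (μ := haar2 q) (fun x => ‖g x‖ₑ ^ p.toReal)]
        simp

end Projection

/-! ## The decoupling constant as the norm of a linear operator -/

section Operator

variable {q : ℕ} [Fact q.Prime] {δ : ℝ}

theorem finite_intervals (q : ℕ) [Fact q.Prime] {δ : ℝ} (hδ : 0 < δ) :
    (intervals q δ).Finite := by
  obtain ⟨t, -, ht⟩ := (isCompact_closedBall (0 : ℚ_[q]) 1).elim_nhds_subcover
    (fun x => Metric.closedBall x δ) fun x _ => Metric.closedBall_mem_nhds x hδ
  refine ((t : Set ℚ_[q]).toFinite.image fun x => Metric.closedBall x δ).subset ?_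
  rintro _ ⟨a, ha, rfl⟩
  obtain ⟨x, hx, hax⟩ := Set.mem_iUnion₂.1 (ht (mem_closedBall_zero_iff.2 ha))
  exact ⟨x, hx, IsUltrametricDist.closedBall_eq_of_mem hax⟩

/-- A centre of an interval. -/
def center (K : intervals q δ) : ℚ_[q] := K.2.choose

theorem coe_eq_closedBall_center (K : intervals q δ) :
    (K : Set ℚ_[q]) = Metric.closedBall (center K) δ := K.2.choose_spec.2

theorem eq_of_mem_of_mem {K K' : intervals q δ} {x : ℚ_[q]} (h : x ∈ (K : Set ℚ_[q]))
    (h' : x ∈ (K' : Set ℚ_[q])) : K = K' := by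
  apply Subtype.ext
  rw [coe_eq_closedBall_center] at h h'
  rw [coe_eq_closedBall_center, coe_eq_closedBall_center K',
    IsUltrametricDist.closedBall_eq_of_mem h, IsUltrametricDist.closedBall_eq_of_mem h']

/-- The Fourier projection onto `θ_K`. -/
def intervalProj (D : ℚ_[q]) (K : intervals q ‖D‖) : schwartz q →ₗ[ℂ] schwartz q :=
  projLM D (center K)

variable {D : ℚ_[q]}

theorem fourier_intervalProj (hD : D ≠ 0) (K : intervals q ‖D‖) (g : schwartz q) :
    fourier (intervalProj D K g : ℚ_[q] × ℚ_[q] → ℂ) =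
      (theta (K : Set ℚ_[q]) ‖D‖).indicator (fourier g) := by
  rw [coe_eq_closedBall_center K]
  exact fourier_proj_eq_indicator_theta g.2 hD _

theorem eLpNorm_intervalProj_le (K : intervals q ‖D‖) (g : schwartz q) {p : ℝ≥0∞} (hp : 1 ≤ p) :
    eLpNorm (intervalProj D K g : ℚ_[q] × ℚ_[q] → ℂ) p (haar2 q) ≤
      eLpNorm (g : ℚ_[q] × ℚ_[q] → ℂ) p (haar2 q) :=
  eLpNorm_proj_le g.2 _ _ hp

/-- Distinct intervals are disjoint, so the strip over `K` meets the Fourier support of `f` only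
inside `θ_K`. -/
theorem freqRestrict_eq_intervalProj (hD : D ≠ 0) (f : schwartz q)
    (hf : IsFourierSupported ‖D‖ (f : ℚ_[q] × ℚ_[q] → ℂ)) (K : intervals q ‖D‖) :
    freqRestrict (f : ℚ_[q] × ℚ_[q] → ℂ) K = intervalProj D K f := by
  rw [← fourierInv_fourier (intervalProj D K f).2, fourier_intervalProj hD, freqRestrict]
  congr 1
  ext ξ
  by_cases h0 : fourier (f : ℚ_[q] × ℚ_[q] → ℂ) ξ = 0
  · rw [Set.indicator_apply_eq_zero.2 fun _ => h0, Set.indicator_apply_eq_zero.2 fun _ => h0]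
  obtain ⟨K', hK', hξ⟩ := Set.mem_iUnion₂.1 (hf ξ h0)
  by_cases h1 : ξ.1 ∈ (K : Set ℚ_[q])
  · have : K = ⟨K', hK'⟩ := eq_of_mem_of_mem h1 hξ.1
    subst this
    rw [Set.indicator_of_mem (Set.mem_prod.2 ⟨h1, Set.mem_univ _⟩),
      Set.indicator_of_mem hξ]
  · rw [Set.indicator_of_notMem fun h => h1 h.1, Set.indicator_of_notMem fun h => h1 h.1]

variable [Fintype (intervals q ‖D‖)]

theorem fourier_sum_intervalProj (hD : D ≠ 0) (g : intervals q ‖D‖ → schwartz q)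
    (ξ : ℚ_[q] × ℚ_[q]) :
    fourier ((∑ K, intervalProj D K (g K) : schwartz q) : ℚ_[q] × ℚ_[q] → ℂ) ξ =
      ∑ K : intervals q ‖D‖, (theta (K : Set ℚ_[q]) ‖D‖).indicator (fourier (g K)) ξ := by
  rw [AddSubmonoidClass.coe_finsetSum, fourier_sum _ fun K => (intervalProj D K (g K)).2,
    Finset.sum_apply]
  simp only [fourier_intervalProj hD]

theorem fourier_sum_intervalProj_of_mem (hD : D ≠ 0) (g : intervals q ‖D‖ → schwartz q)
    {K : intervals q ‖D‖} {ξ : ℚ_[q] × ℚ_[q]} (hξ : ξ ∈ theta (K : Set ℚ_[q]) ‖D‖) :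
    fourier ((∑ K, intervalProj D K (g K) : schwartz q) : ℚ_[q] × ℚ_[q] → ℂ) ξ =
      fourier (g K) ξ := by
  rw [fourier_sum_intervalProj hD, Finset.sum_eq_single K, Set.indicator_of_mem hξ]
  · exact fun K' _ hK' => Set.indicator_of_notMem
      (fun h => hK' (eq_of_mem_of_mem h.1 hξ.1)) _
  · simp

theorem sum_intervalProj (hD : D ≠ 0) (f : schwartz q)
    (hf : IsFourierSupported ‖D‖ (f : ℚ_[q] × ℚ_[q] → ℂ)) : ∑ K, intervalProj D K f = f := by
  refine Subtype.ext (IsSchwartz.eq_of_fourier_eq (Subtype.prop _) f.2 ?_)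
  ext ξ
  by_cases h0 : fourier (f : ℚ_[q] × ℚ_[q] → ℂ) ξ = 0
  · rw [fourier_sum_intervalProj hD, h0]
    exact Finset.sum_eq_zero fun K _ => Set.indicator_apply_eq_zero.2 fun _ => h0
  · obtain ⟨K, hK, hξ⟩ := Set.mem_iUnion₂.1 (hf ξ h0)
    exact fourier_sum_intervalProj_of_mem hD (fun _ => f) (K := ⟨K, hK⟩) hξ

theorem isFourierSupported_sum_intervalProj (hD : D ≠ 0) (g : intervals q ‖D‖ → schwartz q) :
    IsFourierSupported ‖D‖
      ((∑ K, intervalProj D K (g K) : schwartz q) : ℚ_[q] × ℚ_[q] → ℂ) := by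
  intro ξ hξ
  rw [fourier_sum_intervalProj hD] at hξ
  obtain ⟨K, -, hK⟩ := Finset.exists_ne_zero_of_sum_ne_zero hξ
  exact Set.mem_iUnion₂.2 ⟨K, K.2, Set.mem_of_indicator_ne_zero hK⟩

theorem intervalProj_sum_intervalProj (hD : D ≠ 0) (g : intervals q ‖D‖ → schwartz q)
    (K : intervals q ‖D‖) :
    intervalProj D K (∑ K', intervalProj D K' (g K')) = intervalProj D K (g K) := by
  refine Subtype.ext (IsSchwartz.eq_of_fourier_eq (Subtype.prop _) (Subtype.prop _) ?_)
  ext ξ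
  rw [fourier_intervalProj hD, fourier_intervalProj hD]
  by_cases h : ξ ∈ theta (K : Set ℚ_[q]) ‖D‖
  · rw [Set.indicator_of_mem h, Set.indicator_of_mem h, fourier_sum_intervalProj_of_mem hD g h]
  · rw [Set.indicator_of_notMem h, Set.indicator_of_notMem h]

variable {p : ℝ≥0∞}

theorem tsum_freqRestrict_eq_sum_intervalProj (hD : D ≠ 0) (f : schwartz q)
    (hf : IsFourierSupported ‖D‖ (f : ℚ_[q] × ℚ_[q] → ℂ)) :
    ∑' K : intervals q ‖D‖, eLpNorm (freqRestrict (f : ℚ_[q] × ℚ_[q] → ℂ) K) p (haar2 q) ^ 2 =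
      ∑ K, eLpNorm (intervalProj D K f : ℚ_[q] × ℚ_[q] → ℂ) p (haar2 q) ^ 2 := by
  simp only [tsum_fintype, freqRestrict_eq_intervalProj hD f hf]

/-- The triangle inequality over the finitely many intervals gives a crude admissible constant. -/
theorem decouplingConst_ne_top (hD : D ≠ 0) (hp : 1 ≤ p) : decouplingConst q p ‖D‖ ≠ ∞ := by
  refine ne_top_of_le_ne_top (b := (Fintype.card (intervals q ‖D‖) : ℝ≥0∞)) (by simp)
    (sInf_le fun f hf hfs => ?_)
  lift f to schwartz q using hf
  rw [tsum_freqRestrict_eq_sum_intervalProj hD f hfs]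
  conv_lhs => rw [← sum_intervalProj hD f hfs, AddSubmonoidClass.coe_finsetSum]
  refine (eLpNorm_sum_le (fun K _ => (IsSchwartz.memLp (Subtype.prop _) p).1) hp).trans ?_
  refine (Finset.sum_le_card_nsmul _ _
    ((∑ K, eLpNorm (intervalProj D K f : ℚ_[q] × ℚ_[q] → ℂ) p (haar2 q) ^ 2) ^ (1 / 2 : ℝ))
    fun K _ => ?_).trans_eq (by simp)
  rw [one_div, ENNReal.le_rpow_inv_iff two_pos, ENNReal.rpow_two]
  exact Finset.single_le_sum
    (f := fun K => eLpNorm (intervalProj D K f : ℚ_[q] × ℚ_[q] → ℂ) p (haar2 q) ^ 2)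
    (fun _ _ => zero_le) (Finset.mem_univ K)

theorem sum_eLpNorm_sq_rpow_ne_top {ι : Type*} [Fintype ι] (g : ι → schwartz q) :
    (∑ i, eLpNorm (g i : ℚ_[q] × ℚ_[q] → ℂ) p (haar2 q) ^ 2) ^ (1 / 2 : ℝ) ≠ ∞ :=
  ENNReal.rpow_ne_top_of_nonneg (by norm_num) (ENNReal.sum_ne_top.2 fun i _ =>
    ENNReal.pow_ne_top (IsSchwartz.memLp (g i).2 p).eLpNorm_ne_top)

/-- The infimum is itself admissible. When the square sum vanishes one cannot divide by it, and a
single admissible constant is used instead. -/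
theorem eLpNorm_le_decouplingConst_mul (hD : D ≠ 0) (hp : 1 ≤ p) (f : schwartz q)
    (hf : IsFourierSupported ‖D‖ (f : ℚ_[q] × ℚ_[q] → ℂ)) :
    eLpNorm (f : ℚ_[q] × ℚ_[q] → ℂ) p (haar2 q) ≤ decouplingConst q p ‖D‖ *
      (∑ K, eLpNorm (intervalProj D K f : ℚ_[q] × ℚ_[q] → ℂ) p (haar2 q) ^ 2) ^ (1 / 2 : ℝ) := by
  have htop := sum_eLpNorm_sq_rpow_ne_top (p := p) fun K => intervalProj D K f
  set S := (∑ K, eLpNorm (intervalProj D K f : ℚ_[q] × ℚ_[q] → ℂ) p (haar2 q) ^ 2) ^ (1 / 2 : ℝ)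
    with hS
  have key : ∀ C ∈ {C : ℝ≥0∞ | ∀ f : ℚ_[q] × ℚ_[q] → ℂ, IsSchwartz f →
      IsFourierSupported ‖D‖ f → eLpNorm f p (haar2 q) ≤
      C * (∑' K : intervals q ‖D‖, eLpNorm (freqRestrict f K) p (haar2 q) ^ 2) ^ (1 / 2 : ℝ)},
      eLpNorm (f : ℚ_[q] × ℚ_[q] → ℂ) p (haar2 q) ≤ C * S := fun C hC => by
    have := hC f f.2 hf
    rwa [tsum_freqRestrict_eq_sum_intervalProj hD f hf] at this
  rcases eq_or_ne S 0 with h0 | h0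
  · obtain ⟨C, hC, -⟩ := sInf_lt_iff.1 (decouplingConst_ne_top (q := q) hD hp).lt_top
    have := key C hC
    rw [h0, mul_zero] at this ⊢
    exact this
  · rw [← ENNReal.div_le_iff h0 htop]
    exact le_sInf fun C hC => (ENNReal.div_le_iff h0 htop).2 (key C hC)

/-- Removes the support condition: the `g K` are arbitrary, as needed for the deformed inputs in the
interpolation. -/
theorem eLpNorm_sum_intervalProj_le (hD : D ≠ 0) (hp : 1 ≤ p)
    (g : intervals q ‖D‖ → schwartz q) :
    eLpNorm ((∑ K, intervalProj D K (g K) : schwartz q) : ℚ_[q] × ℚ_[q] → ℂ) p (haar2 q) ≤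
      decouplingConst q p ‖D‖ *
        (∑ K, eLpNorm (g K : ℚ_[q] × ℚ_[q] → ℂ) p (haar2 q) ^ 2) ^ (1 / 2 : ℝ) := by
  refine (eLpNorm_le_decouplingConst_mul hD hp _
    (isFourierSupported_sum_intervalProj hD g)).trans ?_
  simp only [intervalProj_sum_intervalProj hD]
  gcongr with K
  exact eLpNorm_intervalProj_le K (g K) hp

end Operator

/-! ## Riesz–Thorin interpolation for Schwartz functions -/

section Interpolation

/-- Entire functions that are bounded on the strip `0 ≤ Re z ≤ 1`. -/
def IsStripBounded (F : ℂ → ℂ) : Prop :=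
  Differentiable ℂ F ∧ ∃ C, ∀ z : ℂ, 0 ≤ z.re → z.re ≤ 1 → ‖F z‖ ≤ C

theorem IsStripBounded.mul {F G : ℂ → ℂ} (hF : IsStripBounded F) (hG : IsStripBounded G) :
    IsStripBounded fun z => F z * G z := by
  obtain ⟨hF, A, hA⟩ := hF
  obtain ⟨hG, B, hB⟩ := hG
  refine ⟨hF.mul hG, A * B, fun z h0 h1 => ?_⟩
  rw [norm_mul]
  exact mul_le_mul (hA z h0 h1) (hB z h0 h1) (norm_nonneg _) ((norm_nonneg _).trans (hA z h0 h1))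

theorem IsStripBounded.sum {ι : Type*} (s : Finset ι) {F : ι → ℂ → ℂ}
    (hF : ∀ i, IsStripBounded (F i)) : IsStripBounded fun z => ∑ i ∈ s, F i z := by
  choose hd C hC using hF
  exact ⟨Differentiable.fun_sum fun i _ => hd i, ∑ i ∈ s, C i, fun z h0 h1 =>
    (norm_sum_le _ _).trans (Finset.sum_le_sum fun i _ => hC i z h0 h1)⟩

theorem isStripBounded_const (c : ℂ) : IsStripBounded fun _ => c :=
  ⟨differentiable_const c, ‖c‖, fun _ _ _ => le_rfl⟩

theorem isStripBounded_exp (α β : ℝ) : IsStripBounded fun z => Complex.exp (α * z + β) := by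
  refine ⟨by fun_prop, Real.exp (|α| + β), fun z h0 h1 => ?_⟩
  rw [Complex.norm_exp, Real.exp_le_exp]
  simp only [Complex.add_re, Complex.re_ofReal_mul, Complex.ofReal_re]
  have h2 : α * z.re ≤ |α| * z.re := mul_le_mul_of_nonneg_right (le_abs_self α) h0
  have h3 : |α| * z.re ≤ |α| := mul_le_of_le_one_right (abs_nonneg α) h1
  linarith

theorem IsStripBounded.norm_le {F : ℂ → ℂ} (hF : IsStripBounded F) {A B t : ℝ} (ht0 : 0 ≤ t)
    (ht1 : t ≤ 1) (hA : ∀ z : ℂ, z.re = 0 → ‖F z‖ ≤ A) (hB : ∀ z : ℂ, z.re = 1 → ‖F z‖ ≤ B) :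
    ‖F t‖ ≤ A ^ (1 - t) * B ^ t := by
  obtain ⟨hd, C, hC⟩ := hF
  simpa using Complex.HadamardThreeLines.norm_le_interp_of_mem_verticalClosedStrip₀₁' F
    (z := (t : ℂ)) (by simp [Complex.HadamardThreeLines.verticalClosedStrip, ht0, ht1])
    hd.diffContOnCl ⟨C, by rintro _ ⟨z, hz, rfl⟩; exact hC z hz.1 hz.2⟩ hA hB

/-- The analytic deformation `v ↦ v ‖v‖^(w-1) N^(1-w)`. -/
def inputTwist (N : ℝ) (w v : ℂ) : ℂ :=
  v / ‖v‖ * Complex.exp (w * Real.log ‖v‖ + (1 - w) * Real.log N)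

/-- The analytic deformation `v ↦ conj v ‖v‖^(P-w-1)`. -/
def dualTwist (P : ℝ) (w v : ℂ) : ℂ :=
  starRingEnd ℂ v / ‖v‖ * Complex.exp ((P - w) * Real.log ‖v‖)

theorem inputTwist_zero (N : ℝ) (w : ℂ) : inputTwist N w 0 = 0 := by simp [inputTwist]

theorem dualTwist_zero (P : ℝ) (w : ℂ) : dualTwist P w 0 = 0 := by simp [dualTwist]

theorem norm_inputTwist (N : ℝ) (w : ℂ) {v : ℂ} (hv : v ≠ 0) :
    ‖inputTwist N w v‖ = Real.exp ((1 - w.re) * Real.log N) * ‖v‖ ^ w.re := by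
  have h : ‖v‖ ≠ 0 := norm_ne_zero_iff.2 hv
  rw [inputTwist, norm_mul, norm_div, Complex.norm_real, norm_norm, div_self h, one_mul,
    Complex.norm_exp, Real.rpow_def_of_pos (norm_pos_iff.2 hv), ← Real.exp_add]
  congr 1
  simp
  ring

theorem norm_dualTwist (P : ℝ) (w : ℂ) {v : ℂ} (hv : v ≠ 0) :
    ‖dualTwist P w v‖ = 1 * ‖v‖ ^ (P - w.re) := by
  have h : ‖v‖ ≠ 0 := norm_ne_zero_iff.2 hv
  rw [dualTwist, norm_mul, norm_div, Complex.norm_real, norm_norm, RCLike.norm_conj, div_self h,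
    Complex.norm_exp, Real.rpow_def_of_pos (norm_pos_iff.2 hv)]
  simp
  ring

theorem inputTwist_one (N : ℝ) (v : ℂ) : inputTwist N 1 v = v := by
  rcases eq_or_ne v 0 with rfl | hv
  · exact inputTwist_zero _ _
  have h : (‖v‖ : ℂ) ≠ 0 := by exact_mod_cast norm_ne_zero_iff.2 hv
  rw [inputTwist, sub_self, zero_mul, one_mul, add_zero, ← Complex.ofReal_exp,
    Real.exp_log (norm_pos_iff.2 hv), div_mul_cancel₀ _ h]

theorem mul_dualTwist_one {P : ℝ} (hP : 0 < P) (v : ℂ) :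
    v * dualTwist P 1 v = ((‖v‖ ^ P : ℝ) : ℂ) := by
  rcases eq_or_ne v 0 with rfl | hv
  · simp [Real.zero_rpow hP.ne']
  have h0 := norm_pos_iff.2 hv
  have h : (‖v‖ : ℂ) ≠ 0 := by exact_mod_cast h0.ne'
  have e : Complex.exp ((P - 1) * Real.log ‖v‖) = ((‖v‖ ^ P / ‖v‖ : ℝ) : ℂ) := by
    rw [← Real.rpow_sub_one h0.ne', Real.rpow_def_of_pos h0]
    push_cast
    rw [mul_comm]
  rw [dualTwist, e, ← mul_assoc, ← mul_div_assoc, Complex.mul_conj, Complex.normSq_eq_norm_sq]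
  push_cast
  field_simp

theorem isStripBounded_inputTwist (N a b : ℝ) (v : ℂ) :
    IsStripBounded fun z => inputTwist N (a * z + b) v := by
  have h := (isStripBounded_const (v / ‖v‖)).mul (isStripBounded_exp
    (a * Real.log ‖v‖ - a * Real.log N) (b * Real.log ‖v‖ + (1 - b) * Real.log N))
  convert! h using 2 with z
  simp only [inputTwist]
  congr 2
  push_cast
  ring

theorem isStripBounded_dualTwist (P a b : ℝ) (v : ℂ) :
    IsStripBounded fun z => dualTwist P (a * z + b) v := by
  have h := (isStripBounded_const (starRingEnd ℂ v / ‖v‖)).mul (isStripBounded_exp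
    (-a * Real.log ‖v‖) ((P - b) * Real.log ‖v‖))
  convert! h using 2 with z
  simp only [dualTwist]
  congr 2
  push_cast
  ring

variable {q : ℕ} [Fact q.Prime]

/-- Composition of a Schwartz function with a function fixing `0`. -/
def schwartzComp (φ : ℂ → ℂ) (hφ : φ 0 = 0) (f : schwartz q) : schwartz q :=
  ⟨φ ∘ f, IsSchwartz.comp f.2 hφ⟩

/-- The indicator function of the level set `{f = v}`, for `v ≠ 0`. -/
def levelIndicator (v : ℂ) (f : schwartz q) : schwartz q :=
  schwartzComp (fun t => if t = v ∧ t ≠ 0 then 1 else 0) (by simp) f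

/-- Isolates the dependence on `φ` in finitely many scalars. The value `v = 0` contributes nothing,
so every term is compactly supported. -/
theorem schwartzComp_eq_sum (φ : ℂ → ℂ) (hφ : φ 0 = 0) (f : schwartz q) :
    schwartzComp φ hφ f =
      ∑ v ∈ (IsSchwartz.finite_range f.2).toFinset, φ v • levelIndicator v f := by
  ext x
  rw [AddSubmonoidClass.coe_finsetSum, Finset.sum_apply]
  rw [Finset.sum_eq_single ((f : ℚ_[q] × ℚ_[q] → ℂ) x)]
  · by_cases h : (f : ℚ_[q] × ℚ_[q] → ℂ) x = 0 <;> simp [schwartzComp, levelIndicator, h, hφ]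
  · intro v _ hv
    simp [schwartzComp, levelIndicator, hv.symm]
  · intro h
    exact absurd (by simp) h

/-- The bilinear pairing `∫ f g`. -/
def pairing : schwartz q →ₗ[ℂ] schwartz q →ₗ[ℂ] ℂ :=
  LinearMap.mk₂ ℂ (fun f g => ∫ x, f.1 x * g.1 x ∂haar2 q)
    (fun f f' g => by
      simp only [Submodule.coe_add, Pi.add_apply, add_mul]
      exact integral_add (IsSchwartz.mul f.2 g.2).integrable (IsSchwartz.mul f'.2 g.2).integrable)
    (fun c f g => by
      simp only [Submodule.coe_smul, Pi.smul_apply, smul_eq_mul, mul_assoc]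
      exact integral_const_mul _ _)
    (fun f g g' => by
      simp only [Submodule.coe_add, Pi.add_apply, mul_add]
      exact integral_add (IsSchwartz.mul f.2 g.2).integrable (IsSchwartz.mul f.2 g'.2).integrable)
    (fun c f g => by
      simp only [Submodule.coe_smul, Pi.smul_apply, smul_eq_mul, mul_left_comm]
      exact integral_const_mul _ _)

theorem pairing_apply (f g : schwartz q) :
    pairing f g = ∫ x, f.1 x * g.1 x ∂haar2 q := rfl

theorem enorm_pairing_le (f g : schwartz q) (r r' : ℝ≥0∞) [r.HolderConjugate r'] :
    ‖pairing f g‖ₑ ≤ eLpNorm f.1 r (haar2 q) * eLpNorm g.1 r' (haar2 q) := by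
  refine (enorm_integral_le_lintegral_enorm _).trans ?_
  rw [← eLpNorm_one_eq_lintegral_enorm]
  have h := eLpNorm_smul_le_mul_eLpNorm (p := r) (q := r') (r := 1) (f := g.1) (φ := f.1)
    (μ := haar2 q) (IsSchwartz.memLp g.2 r').1 (IsSchwartz.memLp f.2 r).1
  exact h

/-- With `t = p / r`, `‖u‖^r` is a multiple of `‖f‖^p`. The zeros of `f` are treated separately
because `t = 0` when `r = ∞`, and `0 ^ 0 = 1`. -/
theorem eLpNorm_le_of_norm_eq_rpow {f u : ℚ_[q] × ℚ_[q] → ℂ} {p r : ℝ≥0∞} (hp : p ≠ 0)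
    (hpt : p ≠ ∞) (hr : 1 ≤ r) {A t : ℝ} (hA : 0 ≤ A) (ht : t = p.toReal * (1 / r).toReal)
    (h0 : ∀ x, f x = 0 → u x = 0) (h : ∀ x, f x ≠ 0 → ‖u x‖ = A * ‖f x‖ ^ t) :
    eLpNorm u r (haar2 q) ≤ ENNReal.ofReal A * eLpNorm f p (haar2 q) ^ t := by
  have hP := ENNReal.toReal_pos hp hpt
  rcases eq_or_ne r ∞ with rfl | hrt
  · have ht0 : t = 0 := by simp [ht]
    rw [ht0, ENNReal.rpow_zero, mul_one, eLpNorm_exponent_top]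
    refine eLpNormEssSup_le_of_ae_bound (.of_forall fun x => ?_)
    by_cases hx : f x = 0
    · simpa [h0 x hx] using hA
    · rw [h x hx, ht0, Real.rpow_zero, mul_one]
  · have hr0 : r ≠ 0 := (zero_lt_one.trans_le hr).ne'
    have hR := ENNReal.toReal_pos hr0 hrt
    have ht' : t = p.toReal / r.toReal := by simp [ht, div_eq_mul_inv]
    have htpos : 0 < t := ht' ▸ div_pos hP hR
    have e1 : eLpNorm u r (haar2 q) = eLpNorm (A • fun x => ‖f x‖ ^ t) r (haar2 q) := by
      refine eLpNorm_congr_norm_ae (.of_forall fun x => ?_)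
      by_cases hx : f x = 0
      · simp [h0 x hx, hx, Real.zero_rpow htpos.ne']
      · rw [h x hx, Pi.smul_apply, smul_eq_mul, Real.norm_of_nonneg (by positivity)]
    have e2 : r * ENNReal.ofReal t = p := by
      rw [ht', ENNReal.ofReal_div_of_pos hR, ENNReal.ofReal_toReal hpt, ENNReal.ofReal_toReal hrt,
        ENNReal.mul_div_cancel hr0 hrt]
    rw [e1, eLpNorm_const_smul, eLpNorm_norm_rpow _ htpos, e2, Real.enorm_of_nonneg hA]

/-- For `N = ‖f‖_p` the two factors are `N^(1 - p/r)` and `N^(p/r)`, whose product is `N` whatever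
`r` is. -/
theorem eLpNorm_inputTwist_le (f : schwartz q) {p r : ℝ≥0∞} (hp : p ≠ 0) (hpt : p ≠ ∞)
    (hr : 1 ≤ r) {w : ℂ} (hw : w.re = p.toReal * (1 / r).toReal) :
    eLpNorm (inputTwist (eLpNorm f.1 p (haar2 q)).toReal w ∘ f.1) r (haar2 q) ≤
      eLpNorm f.1 p (haar2 q) := by
  have hfin := (IsSchwartz.memLp f.2 p).eLpNorm_ne_top
  rcases eq_or_ne (eLpNorm f.1 p (haar2 q)) 0 with hN | hN
  · rw [hN, nonpos_iff_eq_zero]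
    have hf := (eLpNorm_eq_zero_iff (IsSchwartz.memLp f.2 p).1 hp).1 hN
    refine eLpNorm_eq_zero_of_ae_zero (hf.mono fun x hx => ?_)
    simp only [Function.comp_apply, hx, Pi.zero_apply, inputTwist_zero]
  · set N := (eLpNorm f.1 p (haar2 q)).toReal with hNdef
    have hNpos : 0 < N := ENNReal.toReal_pos hN hfin
    refine (eLpNorm_le_of_norm_eq_rpow hp hpt hr (Real.exp_nonneg _) hw
      (fun x hx => by simp only [hx, inputTwist_zero])
      (fun x hx => norm_inputTwist N w hx)).trans_eq ?_
    rw [← ENNReal.ofReal_toReal hfin, ← hNdef, ENNReal.ofReal_rpow_of_pos hNpos,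
      ← ENNReal.ofReal_mul (Real.exp_nonneg _), mul_comm (1 - w.re), ← Real.rpow_def_of_pos hNpos,
      ← Real.rpow_add hNpos, sub_add_cancel, Real.rpow_one]

theorem eLpNorm_dualTwist_le (f : schwartz q) {p r r' : ℝ≥0∞} [r.HolderConjugate r'] (hp : p ≠ 0)
    (hpt : p ≠ ∞) {w : ℂ} (hw : w.re = p.toReal * (1 / r).toReal) :
    eLpNorm (dualTwist p.toReal w ∘ f.1) r' (haar2 q) ≤
      eLpNorm f.1 p (haar2 q) ^ (p.toReal - w.re) := by
  have h1 : (1 / r).toReal + (1 / r').toReal = 1 := by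
    have hr := (ENNReal.HolderConjugate.one_le r r')
    have hr' := (ENNReal.HolderConjugate.one_le r' r)
    rw [← ENNReal.toReal_add, one_div, one_div, ENNReal.HolderConjugate.inv_add_inv_eq_one,
      ENNReal.toReal_one]
    · simpa using (zero_lt_one.trans_le hr).ne'
    · simpa using (zero_lt_one.trans_le hr').ne'
  have h2 : p.toReal - w.re = p.toReal * (1 / r').toReal := by
    rw [hw, ← mul_one_sub, ← h1, add_sub_cancel_left]
  refine (eLpNorm_le_of_norm_eq_rpow hp hpt (ENNReal.HolderConjugate.one_le r' r) zero_le_one h2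
    (fun x hx => by simp only [hx, dualTwist_zero])
    (fun x hx => norm_dualTwist _ w hx)).trans_eq (by simp)

variable {ι : Type*} [Fintype ι]

/-- The analytic family whose value at `w = 1` is `‖∑ T i (f i)‖_p^p`. -/
def twistedPairing (T : ι → schwartz q →ₗ[ℂ] schwartz q) (f : ι → schwartz q) (p : ℝ≥0∞)
    (w : ℂ) : ℂ :=
  pairing (∑ i, T i (schwartzComp (inputTwist (eLpNorm (f i).1 p (haar2 q)).toReal w)
      (inputTwist_zero _ _) (f i)))
    (schwartzComp (dualTwist p.toReal w) (dualTwist_zero _ _) (∑ i, T i (f i)))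

theorem isStripBounded_twistedPairing (T : ι → schwartz q →ₗ[ℂ] schwartz q) (f : ι → schwartz q)
    (p : ℝ≥0∞) (a b : ℝ) : IsStripBounded fun z => twistedPairing T f p (a * z + b) := by
  simp only [twistedPairing, schwartzComp_eq_sum, map_sum, map_smul, LinearMap.sum_apply,
    LinearMap.smul_apply, smul_eq_mul]
  refine .sum _ fun _ => .mul (isStripBounded_dualTwist _ _ _ _) ?_
  refine .sum _ fun _ => .sum _ fun _ => ?_
  exact .mul (isStripBounded_inputTwist _ _ _ _) (isStripBounded_const _)

theorem twistedPairing_one (T : ι → schwartz q →ₗ[ℂ] schwartz q) (f : ι → schwartz q)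
    {p : ℝ≥0∞} (hp : p ≠ 0) (hpt : p ≠ ∞) :
    twistedPairing T f p 1 =
      (((eLpNorm (∑ i, T i (f i) : schwartz q).1 p (haar2 q)).toReal ^ p.toReal : ℝ) : ℂ) := by
  have hP := ENNReal.toReal_pos hp hpt
  have h1 : ∀ i, schwartzComp (inputTwist (eLpNorm (f i).1 p (haar2 q)).toReal 1)
      (inputTwist_zero _ _) (f i) = f i := fun i => by
    ext x
    exact inputTwist_one _ _
  simp only [twistedPairing, h1]
  have hL := IsSchwartz.memLp (∑ i, T i (f i) : schwartz q).2 p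
  rw [pairing_apply, hL.eLpNorm_eq_integral_rpow_norm hp hpt,
    ENNReal.toReal_ofReal (by positivity),
    ← Real.rpow_mul (integral_nonneg fun x => by positivity),
    inv_mul_cancel₀ hP.ne', Real.rpow_one, ← integral_complex_ofReal]
  congr 1
  ext x
  exact mul_dualTwist_one hP _

/-- Hölder with exponents `r, r'`, the assumed `L^r` bound on the deformed inputs, and `p - p/r =
p/r'` for the dual factor. -/
theorem norm_twistedPairing_le (T : ι → schwartz q →ₗ[ℂ] schwartz q) (f : ι → schwartz q)
    {p r : ℝ≥0∞} (hp : p ≠ 0) (hpt : p ≠ ∞) (hr : 1 ≤ r) {C : ℝ≥0∞} (hC : C ≠ ∞)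
    (hT : ∀ g : ι → schwartz q, eLpNorm (∑ i, T i (g i) : schwartz q).1 r (haar2 q) ≤
      C * (∑ i, eLpNorm (g i).1 r (haar2 q) ^ 2) ^ (1 / 2 : ℝ))
    {w : ℂ} (hw : w.re = p.toReal * (1 / r).toReal) :
    ‖twistedPairing T f p w‖ ≤
      C.toReal * ((∑ i, eLpNorm (f i).1 p (haar2 q) ^ 2) ^ (1 / 2 : ℝ)).toReal *
        (eLpNorm (∑ i, T i (f i) : schwartz q).1 p (haar2 q)).toReal ^
          (p.toReal - p.toReal * (1 / r).toReal) := by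
  rw [← hw]
  have := ENNReal.HolderConjugate.conjExponent hr
  have hle : (1 / r).toReal ≤ 1 := by
    rw [← ENNReal.toReal_one]
    exact ENNReal.toReal_mono (by simp) (by simpa using hr)
  have hexp : 0 ≤ p.toReal - w.re := by
    rw [hw, ← mul_one_sub]
    exact mul_nonneg ENNReal.toReal_nonneg (sub_nonneg.2 hle)
  have h1 : ‖twistedPairing T f p w‖ₑ ≤
      C * (∑ i, eLpNorm (f i).1 p (haar2 q) ^ 2) ^ (1 / 2 : ℝ) *
        eLpNorm (∑ i, T i (f i) : schwartz q).1 p (haar2 q) ^ (p.toReal - w.re) := by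
    refine (enorm_pairing_le _ _ r r.conjExponent).trans (mul_le_mul' ((hT _).trans ?_) ?_)
    · gcongr with i
      exact eLpNorm_inputTwist_le (f i) hp hpt hr hw
    · exact eLpNorm_dualTwist_le _ hp hpt hw
  have h2 := ENNReal.toReal_mono (ENNReal.mul_ne_top (ENNReal.mul_ne_top hC
    (sum_eLpNorm_sq_rpow_ne_top f)) (ENNReal.rpow_ne_top_of_nonneg hexp
      (IsSchwartz.memLp (∑ i, T i (f i) : schwartz q).2 p).eLpNorm_ne_top)) h1
  rwa [toReal_enorm, ENNReal.toReal_mul, ENNReal.toReal_mul,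
    ← ENNReal.toReal_rpow _ (p.toReal - w.re)] at h2

/-- **Riesz–Thorin interpolation** between `ℓ²L^r → L^r` bounds, for Schwartz functions. -/
theorem eLpNorm_sum_le_of_interpolation (T : ι → schwartz q →ₗ[ℂ] schwartz q)
    {p p₀ p₁ : ℝ≥0∞} (hp : p ≠ 0) (hpt : p ≠ ∞) (hp₀ : 1 ≤ p₀) (hp₁ : 1 ≤ p₁) {θ : ℝ}
    (hθ₀ : 0 ≤ θ) (hθ₁ : θ ≤ 1)
    (hθ : p.toReal * (θ * (1 / p₀).toReal + (1 - θ) * (1 / p₁).toReal) = 1)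
    {C₀ C₁ : ℝ≥0∞} (hC₀ : C₀ ≠ ∞) (hC₁ : C₁ ≠ ∞)
    (hT₀ : ∀ g : ι → schwartz q, eLpNorm (∑ i, T i (g i) : schwartz q).1 p₀ (haar2 q) ≤
      C₀ * (∑ i, eLpNorm (g i).1 p₀ (haar2 q) ^ 2) ^ (1 / 2 : ℝ))
    (hT₁ : ∀ g : ι → schwartz q, eLpNorm (∑ i, T i (g i) : schwartz q).1 p₁ (haar2 q) ≤
      C₁ * (∑ i, eLpNorm (g i).1 p₁ (haar2 q) ^ 2) ^ (1 / 2 : ℝ))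
    (f : ι → schwartz q) :
    eLpNorm (∑ i, T i (f i) : schwartz q).1 p (haar2 q) ≤
      C₀ ^ θ * C₁ ^ (1 - θ) * (∑ i, eLpNorm (f i).1 p (haar2 q) ^ 2) ^ (1 / 2 : ℝ) := by
  have hMtop := (IsSchwartz.memLp (∑ i, T i (f i) : schwartz q).2 p).eLpNorm_ne_top
  have hStop := sum_eLpNorm_sq_rpow_ne_top (p := p) f
  rcases eq_or_ne (eLpNorm (∑ i, T i (f i) : schwartz q).1 p (haar2 q)) 0 with hM0 | hM0
  · rw [hM0]
    exact zero_le
  have hCtop : C₀ ^ θ * C₁ ^ (1 - θ) ≠ ∞ := ENNReal.mul_ne_top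
    (ENNReal.rpow_ne_top_of_nonneg hθ₀ hC₀)
    (ENNReal.rpow_ne_top_of_nonneg (sub_nonneg.2 hθ₁) hC₁)
  have e₀ : ∀ z : ℂ, z.re = 1 →
      ((p.toReal * (1 / p₀).toReal - p.toReal * (1 / p₁).toReal : ℝ) * z +
      (p.toReal * (1 / p₁).toReal : ℝ) : ℂ).re = p.toReal * (1 / p₀).toReal := fun z hz => by
    rw [Complex.add_re, Complex.re_ofReal_mul, Complex.ofReal_re, hz]
    ring
  have e₁ : ∀ z : ℂ, z.re = 0 →
      ((p.toReal * (1 / p₀).toReal - p.toReal * (1 / p₁).toReal : ℝ) * z +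
      (p.toReal * (1 / p₁).toReal : ℝ) : ℂ).re = p.toReal * (1 / p₁).toReal := fun z hz => by
    rw [Complex.add_re, Complex.re_ofReal_mul, Complex.ofReal_re, hz]
    ring
  -- The affine map `z ↦ w` sends `Re z = 0` to `Re w = p/p₁`, `Re z = 1` to `Re w = p/p₀`, and `z =
  -- θ` to `w = 1`, where the pairing is `‖∑ T i (f i)‖_p^p`.
  have key := (isStripBounded_twistedPairing T f p
    (p.toReal * (1 / p₀).toReal - p.toReal * (1 / p₁).toReal)
    (p.toReal * (1 / p₁).toReal)).norm_le hθ₀ hθ₁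
    (fun z hz => norm_twistedPairing_le T f hp hpt hp₁ hC₁ hT₁ (e₁ z hz))
    (fun z hz => norm_twistedPairing_le T f hp hpt hp₀ hC₀ hT₀ (e₀ z hz))
  have e : ((p.toReal * (1 / p₀).toReal - p.toReal * (1 / p₁).toReal : ℝ) * (θ : ℂ) +
      (p.toReal * (1 / p₁).toReal : ℝ) : ℂ) = 1 := by
    rw [← Complex.ofReal_mul, ← Complex.ofReal_add, ← Complex.ofReal_one, ← hθ]
    congr 1
    ring
  rw [e, twistedPairing_one T f hp hpt, Complex.norm_real,
    Real.norm_of_nonneg (Real.rpow_nonneg ENNReal.toReal_nonneg _)] at key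
  rw [← ENNReal.toReal_le_toReal hMtop (ENNReal.mul_ne_top hCtop hStop), ENNReal.toReal_mul,
    ENNReal.toReal_mul, ← ENNReal.toReal_rpow, ← ENNReal.toReal_rpow]
  have hM : 0 < (eLpNorm (∑ i, T i (f i) : schwartz q).1 p (haar2 q)).toReal :=
    ENNReal.toReal_pos hM0 hMtop
  generalize (eLpNorm (∑ i, T i (f i) : schwartz q).1 p (haar2 q)).toReal = M at key hM ⊢
  have hS : 0 ≤ ((∑ i, eLpNorm (f i).1 p (haar2 q) ^ 2) ^ (1 / 2 : ℝ)).toReal :=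
    ENNReal.toReal_nonneg
  generalize ((∑ i, eLpNorm (f i).1 p (haar2 q) ^ 2) ^ (1 / 2 : ℝ)).toReal = S at key hS ⊢
  have hc₀ : 0 ≤ C₀.toReal := ENNReal.toReal_nonneg
  have hc₁ : 0 ≤ C₁.toReal := ENNReal.toReal_nonneg
  rw [Real.mul_rpow (by positivity) (by positivity), Real.mul_rpow hc₁ hS,
    Real.mul_rpow (by positivity) (by positivity), Real.mul_rpow hc₀ hS,
    ← Real.rpow_mul hM.le, ← Real.rpow_mul hM.le] at key
  have hSS : S ^ (1 - θ) * S ^ θ = S := by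
    rw [← Real.rpow_add_of_nonneg hS (sub_nonneg.2 hθ₁) hθ₀, sub_add_cancel, Real.rpow_one]
  -- The dual factors combine to `M ^ (p - 1)`, so cancelling them from `M ^ p` leaves the desired
  -- bound on `M`.
  have hMM : M ^ ((p.toReal - p.toReal * (1 / p₁).toReal) * (1 - θ)) *
      M ^ ((p.toReal - p.toReal * (1 / p₀).toReal) * θ) = M ^ (p.toReal - 1) := by
    rw [← Real.rpow_add hM]
    congr 1
    linear_combination -hθ
  have hpos : 0 < M ^ (p.toReal - 1) := Real.rpow_pos_of_pos hM _
  have hMp : M ^ p.toReal = M * M ^ (p.toReal - 1) := by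
    rw [← Real.rpow_one_add' hM.le (by simpa using (ENNReal.toReal_pos hp hpt).ne'),
      add_sub_cancel]
  refine le_of_mul_le_mul_right ?_ hpos
  rw [← hMp]
  refine key.trans_eq ?_
  rw [← hMM]
  linear_combination (C₀.toReal ^ θ * C₁.toReal ^ (1 - θ) *
    (M ^ ((p.toReal - p.toReal * (1 / p₁).toReal) * (1 - θ)) *
      M ^ ((p.toReal - p.toReal * (1 / p₀).toReal) * θ))) * hSS

end Interpolation

/-! ### Log-convexity of the decoupling constant -/

section LogConvexity

variable {q : ℕ} [Fact q.Prime]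

theorem decouplingConst_le_of_interpolation {D : ℚ_[q]} (hD : D ≠ 0) {p p₀ p₁ : ℝ≥0∞}
    (hp : 1 ≤ p) (hpt : p ≠ ∞) (hp₀ : 1 ≤ p₀) (hp₁ : 1 ≤ p₁) {θ : ℝ} (hθ₀ : 0 ≤ θ) (hθ₁ : θ ≤ 1)
    (hθ : p.toReal * (θ * (1 / p₀).toReal + (1 - θ) * (1 / p₁).toReal) = 1) :
    decouplingConst q p ‖D‖ ≤
      decouplingConst q p₀ ‖D‖ ^ θ * decouplingConst q p₁ ‖D‖ ^ (1 - θ) := by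
  have := (finite_intervals q (norm_pos_iff.2 hD)).fintype
  refine sInf_le fun f hf hfs => ?_
  lift f to schwartz q using hf
  rw [tsum_freqRestrict_eq_sum_intervalProj hD f hfs]
  have h := eLpNorm_sum_le_of_interpolation (intervalProj D) (zero_lt_one.trans_le hp).ne' hpt
    hp₀ hp₁ hθ₀ hθ₁ hθ (decouplingConst_ne_top hD hp₀) (decouplingConst_ne_top hD hp₁)
    (fun g => eLpNorm_sum_intervalProj_le hD hp₀ g)
    (fun g => eLpNorm_sum_intervalProj_le hD hp₁ g) (fun K => intervalProj D K f)
  -- Idempotence: applied to the tuple of pieces of `f`, the operator returns `f`.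
  have e : ∀ K, intervalProj D K (intervalProj D K f) = intervalProj D K f := fun K =>
    Subtype.ext (IsSchwartz.eq_of_fourier_eq (Subtype.prop _) (Subtype.prop _) (by
      rw [fourier_intervalProj hD, fourier_intervalProj hD, Set.indicator_indicator,
        Set.inter_self]))
  simp only [e, sum_intervalProj hD f hfs] at h
  exact h

end LogConvexity

end PadicDecoupling

end

theorem mainTheorem4 (q : ℕ) [Fact q.Prime] (hq : Odd q) (k : ℕ) (δ : ℝ)
    (hδ : δ = (q : ℝ) ^ (-(k : ℤ)))
    (p p₀ p₁ : ℝ≥0∞) (hp₀ : 1 ≤ p₀) (hp₁ : 1 ≤ p₁)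
    (θ : ℝ) (hθ₀ : 0 ≤ θ) (hθ₁ : θ ≤ 1)
    (hp : 1 / p = ENNReal.ofReal θ / p₀ + ENNReal.ofReal (1 - θ) / p₁) :
    PadicDecoupling.decouplingConst q p δ ≤
      PadicDecoupling.decouplingConst q p₀ δ ^ θ *
        PadicDecoupling.decouplingConst q p₁ δ ^ (1 - θ) := by
  have hq0 : (q : ℚ_[q]) ≠ 0 := by exact_mod_cast (Fact.out : q.Prime).ne_zero
  have hδ' : δ = ‖(q : ℚ_[q]) ^ k‖ := by
    rw [hδ, norm_pow, Padic.norm_p, zpow_neg, zpow_natCast, inv_pow]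
  have hinv : ∀ r : ℝ≥0∞, 1 ≤ r → 1 / r ≤ 1 := fun r hr => by simpa using hr
  have hp1 : 1 ≤ p := by
    have h : 1 / p ≤ 1 := by
      rw [hp, ← ENNReal.ofReal_one, ← add_sub_cancel θ 1,
        ENNReal.ofReal_add hθ₀ (sub_nonneg.2 hθ₁)]
      rw [add_sub_cancel_left, div_eq_mul_one_div, div_eq_mul_one_div (ENNReal.ofReal (1 - θ))]
      exact add_le_add (mul_le_of_le_one_right' (hinv _ hp₀))
        (mul_le_of_le_one_right' (hinv _ hp₁))
    simpa using h
  -- If `p = ∞`, both terms of `hp` vanish, so an endpoint of infinite exponent has full weight or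
  -- both exponents are infinite; the two sides then coincide.
  rcases eq_or_ne p ∞ with rfl | hpt
  · rw [ENNReal.div_top, eq_comm, add_eq_zero, ENNReal.div_eq_zero_iff, ENNReal.div_eq_zero_iff,
      ENNReal.ofReal_eq_zero, ENNReal.ofReal_eq_zero] at hp
    obtain ⟨h | h, h' | h'⟩ := hp
    · linarith
    · obtain rfl : θ = 0 := le_antisymm h hθ₀
      simp [h']
    · obtain rfl : θ = 1 := by linarith
      simp [h]
    · rw [h, h', ← ENNReal.rpow_add_of_nonneg _ _ hθ₀ (sub_nonneg.2 hθ₁), add_sub_cancel,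
        ENNReal.rpow_one]
  · rw [hδ']
    refine PadicDecoupling.decouplingConst_le_of_interpolation (pow_ne_zero k hq0) hp1 hpt hp₀ hp₁
      hθ₀ hθ₁ ?_
    have hp0 : p ≠ 0 := (zero_lt_one.trans_le hp1).ne'
    have hfin : ∀ r : ℝ≥0∞, 1 ≤ r → ∀ t : ℝ, ENNReal.ofReal t / r ≠ ∞ := fun r hr t =>
      ENNReal.div_ne_top ENNReal.ofReal_ne_top (zero_lt_one.trans_le hr).ne'
    have h := congrArg ENNReal.toReal hp
    rw [ENNReal.toReal_add (hfin _ hp₀ _) (hfin _ hp₁ _)] at h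
    simp only [ENNReal.toReal_div, ENNReal.toReal_ofReal hθ₀,
      ENNReal.toReal_ofReal (sub_nonneg.2 hθ₁),
      ENNReal.toReal_one] at h ⊢
    rw [mul_one_div, mul_one_div, ← h, mul_one_div_cancel (ENNReal.toReal_pos hp0 hpt).ne']
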